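/- **Theorem (isoperimetric weak Pontryagin maximum principle with time delay).** Let $t_1<t_2$, $0<\tau<t_2-t_1$, and let $L:[t_1,t_2]\times\mathbb R^n\times\mathbb R^m\times\mathbb R^n\times\mathbb R^m\to\mathbb R$, and $g$, $\varphi$ on the same domain with values in $\mathbb R^k$ and $\mathbb R^n$, be $C^1$ functions. Write $[q,u]_\tau(t)=(t,q(t),u(t),q(t-\tau),u(t-\tau))$. Consider the problem of minimizing $$\int_{t_1}^{t_2}L[q,u]_\tau(t)\,dt$$ over all $q\in C^1([t_1-\tau,t_2];\mathbb R^n)$, $u\in C^0([t_1-\tau,t_2];\mathbb R^m)$ subject to $$\dot q(t)=\varphi[q,u]_\tau(t)\ \ (t\in[t_1,t_2]),\qquad \int_{t_1}^{t_2}g[q,u]_\tau(t)\,dt=l,\qquad q(t)=\delta(t)\ \ (t\in[t_1-\tau,t_1]),$$ where $l\in\mathbb R^k$ and $\delta$ are given. For $\lambda\in\mathbb R^k$ and $p:[t_1,t_2]\to\mathbb R^n$ put $$H(t,q,u,q_\tau,u_\tau,p,\lambda)=L-\lambda\cdot g+p\cdot\varphi,\qquad H[t]=H(t,q(t),u(t),q(t-\tau),u(t-\tau),p(t),\lambda),$$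 and let $\partial_iH[t]$ be the partial gradient in the $i$-th argument at that point. Consider the conditions 1. $p$ is continuous on $[t_1,t_2]$ and $C^1$ on each of $[t_1,t_2-\tau]$ and $[t_2-\tau,t_2]$; 2. $\dot q(t)=\partial_6H[t]$ and $\dot p(t)=-\partial_2H[t]-\partial_4H[t+\tau]$ for $t_1\le t\le t_2-\tau$; 3. $\dot q(t)=\partial_6H[t]$ and $\dot p(t)=-\partial_2H[t]$ for $t_2-\tau\le t\le t_2$; 4. $\partial_3H[t]+\partial_5H[t+\tau]=0$ for $t_1\le t\le t_2-\tau$, and $\partial_3H[t]=0$ for $t_2-\tau\le t\le t_2$, where the derivatives of $p$ are one-sided at the end points of the respective interval. Call an admissible pair $(q,u)$ *abnormal* if there are $\lambda\neq0$ and $p$ with $p(t_2)=0$ satisfying (1)–(4) with $L$ replaced by $0$, and *normal* otherwise. If $(q,u)$ is a minimizer (it suffices: a local minimizer with respect to uniform convergence of $(q,u)$) of the problem and is normal, then there are $\lambda\in\mathbb R^k$ and a covector function $p:[t_1,t_2]\to\mathbb R^n$ satisfying (1)–(4). Moreover, $p\in C^1([t_1,t_2])$ whenever $\partial_4H[t_2]=0$,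 that is, whenever the two equations for $\dot p$ agree at $t=t_2-\tau$. -/

import Mathlib

open Set

noncomputable section

namespace DelayControl

/-- The Euclidean space `ℝⁿ`. -/
abbrev E (n : ℕ) : Type := EuclideanSpace ℝ (Fin n)

/-- The points `(t, q, u, q_τ, u_τ)` at which Lagrangian, constraint and velocity are evaluated
(arguments number 1 to 5). -/
abbrev Pt (n m : ℕ) : Type := ℝ × E n × E m × E n × E m

/-- Data of an isoperimetric optimal control problem with time delay: state in `ℝⁿ`, control
in `ℝᵐ`, and `k` isoperimetric constraints. -/
structure Problem (n m k : ℕ) where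
  t₁ : ℝ
  t₂ : ℝ
  /-- the delay -/
  τ : ℝ
  /-- the Lagrangian -/
  L : Pt n m → ℝ
  /-- the integrand of the isoperimetric constraints -/
  g : Pt n m → E k
  /-- the velocity vector -/
  φ : Pt n m → E n
  /-- the prescribed value of the isoperimetric integrals -/
  l : E k
  /-- the prescribed initial function -/
  δ : ℝ → E n

/-- `[q,u]_τ(t) = (t, q(t), u(t), q(t-τ), u(t-τ))`. -/
def delayPt {n m : ℕ} (τ : ℝ) (q : ℝ → E n) (u : ℝ → E m) (t : ℝ) : Pt n m :=
  (t, q t, u t, q (t - τ), u (t - τ))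

section Partials

variable {n m k : ℕ}

/-! Partial gradients of a function `H` of `(t, q, u, q_τ, u_τ)`, `p` and `λ` with respect to
its second to sixth argument. -/

def d₂ (H : Pt n m → E n → E k → ℝ) (z : Pt n m) (p : E n) (lam : E k) : E n :=
  gradient (fun x : E n => H (z.1, x, z.2.2.1, z.2.2.2.1, z.2.2.2.2) p lam) z.2.1

def d₃ (H : Pt n m → E n → E k → ℝ) (z : Pt n m) (p : E n) (lam : E k) : E m :=
  gradient (fun v : E m => H (z.1, z.2.1, v, z.2.2.2.1, z.2.2.2.2) p lam) z.2.2.1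

def d₄ (H : Pt n m → E n → E k → ℝ) (z : Pt n m) (p : E n) (lam : E k) : E n :=
  gradient (fun y : E n => H (z.1, z.2.1, z.2.2.1, y, z.2.2.2.2) p lam) z.2.2.2.1

def d₅ (H : Pt n m → E n → E k → ℝ) (z : Pt n m) (p : E n) (lam : E k) : E m :=
  gradient (fun w : E m => H (z.1, z.2.1, z.2.2.1, z.2.2.2.1, w) p lam) z.2.2.2.2

def d₆ (H : Pt n m → E n → E k → ℝ) (z : Pt n m) (p : E n) (lam : E k) : E n :=
  gradient (fun r : E n => H z r lam) p

end Partials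

namespace Problem

variable {n m k : ℕ}

/-- The cost `∫ L[q,u]_τ(t) dt` over `[t₁, t₂]`. -/
def cost (P : Problem n m k) (q : ℝ → E n) (u : ℝ → E m) : ℝ :=
  ∫ t in P.t₁..P.t₂, P.L (delayPt P.τ q u t)

/-- `(q, u)` is an admissible pair: `q` is `C¹` and `u` is `C⁰` on `[t₁ - τ, t₂]`, the delayed
control system holds on `[t₁, t₂]`, and the isoperimetric constraints and the initial condition
are satisfied. The terminal state and the initial piece of the control are free. -/
structure IsAdmissible (P : Problem n m k) (q : ℝ → E n) (u : ℝ → E m) : Prop where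
  state_C1 : ContDiffOn ℝ 1 q (Icc (P.t₁ - P.τ) P.t₂)
  control_C0 : ContinuousOn u (Icc (P.t₁ - P.τ) P.t₂)
  dynamics : ∀ t ∈ Icc P.t₁ P.t₂,
    HasDerivWithinAt q (P.φ (delayPt P.τ q u t)) (Icc (P.t₁ - P.τ) P.t₂) t
  isoperimetric : ∫ t in P.t₁..P.t₂, P.g (delayPt P.τ q u t) = P.l
  initial : ∀ t ∈ Icc (P.t₁ - P.τ) P.t₁, q t = P.δ t

/-- `(q, u)` is a (weak) local minimizer: an admissible pair whose cost is minimal among all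
admissible pairs that are uniformly close to it. Global minimizers are local minimizers. -/
def IsLocalMinimizer (P : Problem n m k) (q : ℝ → E n) (u : ℝ → E m) : Prop :=
  P.IsAdmissible q u ∧ ∃ ε > 0, ∀ (q' : ℝ → E n) (u' : ℝ → E m), P.IsAdmissible q' u' →
    (∀ t ∈ Icc (P.t₁ - P.τ) P.t₂, ‖q' t - q t‖ < ε ∧ ‖u' t - u t‖ < ε) →
    P.cost q u ≤ P.cost q' u'

/-- The isoperimetric Hamiltonian `H = L - λ · g + p · φ`. -/
def hamiltonian (P : Problem n m k) (z : Pt n m) (p : E n) (lam : E k) : ℝ :=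
  P.L z - inner ℝ lam (P.g z) + inner ℝ p (P.φ z)

/-- The isoperimetric Hamiltonian system and the stationarity conditions with time delay, for
the covector function `p` and the multiplier `lam`. On each of the intervals `[t₁, t₂ - τ]` and
`[t₂ - τ, t₂]` derivatives of `p` are taken relative to that interval, hence one-sided at its
end points. -/
structure IsPontryaginExtremal (P : Problem n m k) (q : ℝ → E n) (u : ℝ → E m)
    (p : ℝ → E n) (lam : E k) : Prop where
  covector_C1_left : ContDiffOn ℝ 1 p (Icc P.t₁ (P.t₂ - P.τ))
  covector_C1_right : ContDiffOn ℝ 1 p (Icc (P.t₂ - P.τ) P.t₂)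
  state : ∀ t ∈ Icc P.t₁ P.t₂,
    HasDerivWithinAt q (d₆ P.hamiltonian (delayPt P.τ q u t) (p t) lam)
      (Icc (P.t₁ - P.τ) P.t₂) t
  costate_left : ∀ t ∈ Icc P.t₁ (P.t₂ - P.τ),
    HasDerivWithinAt p
      (-d₂ P.hamiltonian (delayPt P.τ q u t) (p t) lam
        - d₄ P.hamiltonian (delayPt P.τ q u (t + P.τ)) (p (t + P.τ)) lam)
      (Icc P.t₁ (P.t₂ - P.τ)) t
  costate_right : ∀ t ∈ Icc (P.t₂ - P.τ) P.t₂,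
    HasDerivWithinAt p (-d₂ P.hamiltonian (delayPt P.τ q u t) (p t) lam)
      (Icc (P.t₂ - P.τ) P.t₂) t
  stationary_left : ∀ t ∈ Icc P.t₁ (P.t₂ - P.τ),
    d₃ P.hamiltonian (delayPt P.τ q u t) (p t) lam
      + d₅ P.hamiltonian (delayPt P.τ q u (t + P.τ)) (p (t + P.τ)) lam = 0
  stationary_right : ∀ t ∈ Icc (P.t₂ - P.τ) P.t₂,
    d₃ P.hamiltonian (delayPt P.τ q u t) (p t) lam = 0

/-- `(q, u)` is abnormal: it is an extremal of some nontrivial linear combination of the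
isoperimetric integrals alone, i.e. for the problem with the Lagrangian `L` replaced by `0` there
is a multiplier `lam ≠ 0` and a covector function, vanishing at the free end point `t₂`, which
satisfy the delayed Hamiltonian system and the stationarity conditions. -/
def IsAbnormal (P : Problem n m k) (q : ℝ → E n) (u : ℝ → E m) : Prop :=
  ∃ (lam : E k) (p : ℝ → E n), lam ≠ 0 ∧ p P.t₂ = 0 ∧
    IsPontryaginExtremal { P with L := fun _ => 0 } q u p lam

/-- `(q, u)` is normal if it is not abnormal; this is automatic when there is no constraint. -/
def IsNormal (P : Problem n m k) (q : ℝ → E n) (u : ℝ → E m) : Prop :=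
  ¬ P.IsAbnormal q u

end Problem

end DelayControl

end

/-! The minimizer is varied by pairs `(h, v)` of continuous functions on $[t_1,t_2]$: the state by
`h`, the control by `v - v(t₁)`. Subtracting `v(t₁)` keeps the control continuous while its initial
piece stays fixed. After integrating the dynamics, the problem becomes a constrained extremum
between Banach spaces: the constraint map consists of the residual of the integrated equation and
the isoperimetric integrals. All maps involved are primitives of superposition operators, which are
strictly differentiable in the uniform norm (`hasStrictFDerivAt_nemytskii`), so the Lagrange
multiplier rule gives a nonzero pair `(Φ, c)`.

The linearized delay equation is solvable for every right-hand side
(`exists_linear_delay_solution`). Hence `Φ` is not needed on the infinite-dimensional factor: its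
restriction `mu` to $\mathbb R^k$ already satisfies `(c, mu) ≠ 0`, and the combined first variation
vanishes on solutions of the linearized equation (`exists_multipliers`).

The covector is not extracted from `Φ`. It is built by solving the adjoint advanced equation
backwards from $p(t_2)=0$, in integrated form (`exists_costate`). Integration by parts then trades
the state variation for `p` and leaves an identity in `v` alone
(`integral_control_variation_eq_zero`). The fundamental lemma makes it pointwise; the two regimes
arise because control values on $(t_2-\tau,t_2)$ never reappear as delayed ones.

If `c = 0`, then `mu ≠ 0` is an abnormal multiplier; otherwise `-mu/c` is the required one. -/

noncomputable section

namespace DelayControl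

open Filter Topology MeasureTheory intervalIntegral

/-! ### Constant extension and Volterra fixed points. -/

section Extension

variable {W : Type*} [NormedAddCommGroup W] {a b : ℝ}

/-- The extension of a continuous function on `[a, b]` that is constant on either side. -/
def extend (hab : a ≤ b) (w : C(Icc a b, W)) (s : ℝ) : W := w (projIcc a b hab s)

theorem continuous_extend (hab : a ≤ b) (w : C(Icc a b, W)) : Continuous (extend hab w) :=
  w.continuous.comp continuous_projIcc

theorem extend_of_mem (hab : a ≤ b) (w : C(Icc a b, W)) {s : ℝ} (hs : s ∈ Icc a b) :
    extend hab w s = w ⟨s, hs⟩ := by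
  rw [extend, projIcc_of_mem hab hs]

theorem extend_coe (hab : a ≤ b) (w : C(Icc a b, W)) (s : Icc a b) :
    extend hab w s = w s := extend_of_mem hab w s.2

theorem extend_of_le (hab : a ≤ b) (w : C(Icc a b, W)) {s : ℝ} (hs : s ≤ a) :
    extend hab w s = w ⟨a, left_mem_Icc.2 hab⟩ := by
  rw [extend, projIcc_of_le_left hab hs]

/-- A map of Volterra type on continuous functions has a fixed point. -/
theorem exists_fixedPoint_of_volterra [CompleteSpace W] (T : C(Icc a b, W) → C(Icc a b, W))
    (ρ : Icc a b → ℝ) (R C : ℝ) (hρ : ∀ t, 0 ≤ ρ t) (hR : ∀ t, ρ t ≤ R) (hC : 0 ≤ C)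
    (hT : ∀ (w w' : C(Icc a b, W)) (M : ℝ) (j : ℕ), 0 ≤ M →
      (∀ s, ‖w s - w' s‖ ≤ M * ρ s ^ j) →
      ∀ t, ‖T w t - T w' t‖ ≤ C * (M * (ρ t ^ (j + 1) / (j + 1)))) :
    ∃ w, T w = w := by
  -- Each application integrates the power of `ρ` once more, so the divisors accumulate to a
  -- factorial.
  have hiter : ∀ (j : ℕ) (w w' : C(Icc a b, W)) (t : Icc a b),
      ‖T^[j] w t - T^[j] w' t‖ ≤ (C ^ j * dist w w' / j.factorial) * ρ t ^ j := by
    intro j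
    induction j with
    | zero =>
      intro w w' t
      simpa [dist_eq_norm] using ContinuousMap.dist_apply_le_dist (f := w) (g := w') t
    | succ j ih =>
      intro w w' t
      rw [Function.iterate_succ_apply', Function.iterate_succ_apply']
      refine (hT _ _ _ j (by positivity) (ih w w') t).trans (le_of_eq ?_)
      rw [Nat.factorial_succ]
      push_cast
      field_simp
      ring
  -- The factorial beats the geometric growth, so some iterate is a contraction even though `T`
  -- itself need not be.
  have hlim : ∀ᶠ j : ℕ in atTop, (C * |R|) ^ j / j.factorial < 1 / 2 :=
    (FloorSemiring.tendsto_pow_div_factorial_atTop (C * |R|)).eventually_lt_const (by norm_num)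
  obtain ⟨j, hj⟩ := hlim.exists
  have hcontr : ContractingWith (1 / 2) T^[j] := by
    refine ⟨by norm_num, LipschitzWith.of_dist_le_mul fun w w' => ?_⟩
    rw [ContinuousMap.dist_le (by positivity)]
    intro t
    rw [dist_eq_norm]
    refine (hiter j w w' t).trans ?_
    have h1 : ρ t ^ j ≤ |R| ^ j := pow_le_pow_left₀ (hρ t) ((hR t).trans (le_abs_self R)) j
    calc (C ^ j * dist w w' / j.factorial) * ρ t ^ j
        ≤ (C ^ j * dist w w' / j.factorial) * |R| ^ j := by gcongr
      _ = ((C * |R|) ^ j / j.factorial) * dist w w' := by rw [mul_pow]; ring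
      _ ≤ 1 / 2 * dist w w' := by gcongr
      _ = _ := by simp
  exact ⟨_, hcontr.isFixedPt_fixedPoint_iterate⟩

end Extension

/-! ### Primitives and superposition operators on continuous functions. -/

section Superposition

variable {Z W : Type*} [NormedAddCommGroup Z] [NormedSpace ℝ Z]
  [NormedAddCommGroup W] [NormedSpace ℝ W] {a b : ℝ}

/-- A function with a continuous one-sided derivative on `[a, b]` is `C¹` there. -/
theorem contDiffOn_one_of_hasDerivWithinAt (hab : a < b) {f f' : ℝ → W}
    (hf : ∀ t ∈ Icc a b, HasDerivWithinAt f (f' t) (Icc a b) t)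
    (hf' : ContinuousOn f' (Icc a b)) : ContDiffOn ℝ 1 f (Icc a b) := by
  rw [contDiffOn_one_iff_derivWithin (uniqueDiffOn_Icc hab)]
  refine ⟨fun t ht => (hf t ht).differentiableWithinAt, hf'.congr fun t ht => ?_⟩
  exact (hf t ht).derivWithin (uniqueDiffOn_Icc hab t ht)

/-- The primitive vanishing at the left end point, as an operator on continuous functions. -/
def primitive (hab : a ≤ b) : C(Icc a b, W) →L[ℝ] C(Icc a b, W) :=
  LinearMap.mkContinuous
    { toFun := fun w => ⟨fun t => ∫ s in a..t, extend hab w s,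
        (continuous_primitive (fun _ _ => (continuous_extend hab w).intervalIntegrable _ _) a).comp
          continuous_subtype_val⟩
      map_add' := fun w w' => by
        ext t
        exact intervalIntegral.integral_add ((continuous_extend hab w).intervalIntegrable _ _)
          ((continuous_extend hab w').intervalIntegrable _ _)
      map_smul' := fun c w => by
        ext t
        exact intervalIntegral.integral_smul c (extend hab w) }
    (b - a) fun w => by
      rw [ContinuousMap.norm_le _ (mul_nonneg (sub_nonneg.2 hab) (norm_nonneg _))]
      intro t
      have h := intervalIntegral.norm_integral_le_of_norm_le_const (a := a) (b := t)
        (f := extend hab w) (C := ‖w‖) fun s _ => w.norm_coe_le_norm _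
      have h1 : |(t : ℝ) - a| ≤ b - a := by
        rw [abs_of_nonneg (sub_nonneg.2 t.2.1)]; linarith [t.2.2]
      calc _ ≤ ‖w‖ * |(t : ℝ) - a| := h
        _ ≤ ‖w‖ * (b - a) := by gcongr
        _ = _ := mul_comm _ _

theorem primitive_apply (hab : a ≤ b) (w : C(Icc a b, W)) (t : Icc a b) :
    primitive hab w t = ∫ s in a..t, extend hab w s := rfl

/-- The superposition operator `z ↦ f(·, z(·))` on continuous functions. -/
def nemytskii (f : ℝ × Z → W) (hf : ContinuousOn f (Icc a b ×ˢ univ)) (z : C(Icc a b, Z)) :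
    C(Icc a b, W) :=
  ⟨fun t => f (t, z t), hf.comp_continuous (by fun_prop) fun t => ⟨t.2, mem_univ _⟩⟩

/-- The partial derivative of `f (t, y)` in `y`. -/
def sliceDeriv (f : ℝ × Z → W) (x : ℝ × Z) : Z →L[ℝ] W := fderiv ℝ (fun y => f (x.1, y)) x.2

/-- Time may only be one-sided, at the end points, but `y` ranges over the whole space: restricting
the derivative within the strip to the `y` direction gives an unrestricted derivative. -/
theorem hasFDerivAt_slice {f : ℝ × Z → W} (hf : ContDiffOn ℝ 1 f (Icc a b ×ˢ univ)) {t : ℝ}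
    (ht : t ∈ Icc a b) (y : Z) :
    HasFDerivAt (fun y => f (t, y))
      ((fderivWithin ℝ f (Icc a b ×ˢ univ) (t, y)).comp (ContinuousLinearMap.inr ℝ ℝ Z)) y := by
  have h1 := (hf.differentiableOn one_ne_zero (t, y) ⟨ht, mem_univ _⟩).hasFDerivWithinAt
  have h2 : HasFDerivWithinAt (fun y : Z => ((t, y) : ℝ × Z))
      (ContinuousLinearMap.inr ℝ ℝ Z) univ y := (hasFDerivAt_prodMk_right t y).hasFDerivWithinAt
  exact hasFDerivWithinAt_univ.1 (h1.comp y h2 fun y _ => ⟨ht, mem_univ _⟩)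

theorem hasFDerivAt_sliceDeriv {f : ℝ × Z → W} (hf : ContDiffOn ℝ 1 f (Icc a b ×ˢ univ)) {t : ℝ}
    (ht : t ∈ Icc a b) (y : Z) : HasFDerivAt (fun y => f (t, y)) (sliceDeriv f (t, y)) y :=
  (hasFDerivAt_slice hf ht y).differentiableAt.hasFDerivAt

theorem continuousOn_sliceDeriv (hab : a < b) {f : ℝ × Z → W}
    (hf : ContDiffOn ℝ 1 f (Icc a b ×ˢ univ)) :
    ContinuousOn (sliceDeriv f) (Icc a b ×ˢ univ) := by
  have h := hf.continuousOn_fderivWithin ((uniqueDiffOn_Icc hab).prod uniqueDiffOn_univ) le_rfl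
  have h2 := h.clm_comp (continuousOn_const (c := ContinuousLinearMap.inr ℝ ℝ Z))
  exact h2.congr fun x hx => (hasFDerivAt_slice hf hx.1 x.2).fderiv

/-- A continuous family of operators, acting pointwise on continuous functions. -/
def pointwise (D : C(Icc a b, Z →L[ℝ] W)) : C(Icc a b, Z) →L[ℝ] C(Icc a b, W) :=
  LinearMap.mkContinuous
    { toFun := fun z => ⟨fun t => D t (z t), D.continuous.clm_apply z.continuous⟩
      map_add' := fun z z' => by ext t; simp
      map_smul' := fun c z => by ext t; simp }
    ‖D‖ fun z => by
      rw [ContinuousMap.norm_le _ (by positivity)]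
      exact fun t => ((D t).le_opNorm _).trans
        (mul_le_mul (D.norm_coe_le_norm t) (z.norm_coe_le_norm t) (norm_nonneg _) (norm_nonneg D))

@[simp]
theorem pointwise_apply (D : C(Icc a b, Z →L[ℝ] W)) (z : C(Icc a b, Z)) (t : Icc a b) :
    pointwise D z t = D t (z t) := rfl

/-- The superposition operator is strictly differentiable with respect to the uniform norm. -/
theorem hasStrictFDerivAt_nemytskii (hab : a < b) {f : ℝ × Z → W}
    (hf : ContDiffOn ℝ 1 f (Icc a b ×ˢ univ)) (z : C(Icc a b, Z)) :
    HasStrictFDerivAt (nemytskii f hf.continuousOn)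
      (pointwise (nemytskii (sliceDeriv f) (continuousOn_sliceDeriv hab hf) z)) z := by
  rw [hasStrictFDerivAt_iff_isLittleO, Asymptotics.isLittleO_iff]
  intro c hc
  -- Compactness of `[a, b]` makes the continuity of the derivative uniform along the graph of `z`;
  -- the mean value inequality on balls then gives strict differentiability, uniformly in `t`.
  have hev : ∀ᶠ d in 𝓝 (0 : Z), ∀ t ∈ (univ : Set (Icc a b)),
      ‖sliceDeriv f (t, z t + d) - sliceDeriv f (t, z t)‖ < c := by
    refine isCompact_univ.eventually_forall_of_forall_eventually fun t _ => ?_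
    have hcont : Continuous fun x : Z × Icc a b =>
        ‖sliceDeriv f (x.2, z x.2 + x.1) - sliceDeriv f (x.2, z x.2)‖ :=
      (((continuousOn_sliceDeriv hab hf).comp_continuous (by fun_prop)
        fun x => ⟨x.2.2, mem_univ _⟩).sub ((continuousOn_sliceDeriv hab hf).comp_continuous
          (by fun_prop) fun x => ⟨x.2.2, mem_univ _⟩)).norm
    refine hcont.continuousAt.eventually_lt continuousAt_const ?_
    simpa using hc
  obtain ⟨r, hr, hball⟩ := Metric.eventually_nhds_iff.1 hev
  filter_upwards [prod_mem_nhds (Metric.ball_mem_nhds z hr) (Metric.ball_mem_nhds z hr)]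
    with x hx
  rw [ContinuousMap.norm_le _ (by positivity)]
  intro t
  have hmem : ∀ y ∈ Metric.ball z r, y t ∈ Metric.ball (z t) r := fun y hy =>
    lt_of_le_of_lt (ContinuousMap.dist_apply_le_dist t) hy
  have hmv := (convex_ball (z t) r).norm_image_sub_le_of_norm_hasFDerivWithin_le'
    (f := fun y => f (t, y)) (f' := fun y => sliceDeriv f (t, y)) (φ := sliceDeriv f (t, z t))
    (C := c) (fun y _ => (hasFDerivAt_sliceDeriv hf t.2 y).hasFDerivWithinAt)
    (fun y hy => by
      have := hball (y := y - z t) (by simpa [dist_eq_norm] using hy) t (mem_univ _)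
      simpa using this.le)
    (hmem x.2 hx.2) (hmem x.1 hx.1)
  refine le_trans hmv ?_
  gcongr
  exact (x.1 - x.2).norm_coe_le_norm t

end Superposition

/-! ### Fundamental lemma and integration by parts with a delay. -/

section Calculus

variable {V : Type*} [NormedAddCommGroup V] [InnerProductSpace ℝ V] {a b : ℝ}

/-- The fundamental lemma of the calculus of variations. -/
theorem eq_zero_of_forall_integral_inner_eq_zero {c d : ℝ} (hcd : c < d) {F : ℝ → V}
    (hF : Continuous F)
    (h : ∀ v : ℝ → V, Continuous v → (∀ s, s ∉ Ioo c d → v s = 0) →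
      ∫ s in c..d, inner ℝ (F s) (v s) = 0) :
    ∀ s ∈ Icc c d, F s = 0 := by
  have hopen : ∀ s ∈ Ioo c d, F s = 0 := by
    by_contra! hne
    obtain ⟨s, hs, hFs⟩ := hne
    -- The test function is `F` itself, multiplied by a cutoff that is positive exactly on `(c, d)`.
    have cψ : Continuous fun x : ℝ => max 0 ((x - c) * (d - x)) := by fun_prop
    have h0 := h (fun x => max 0 ((x - c) * (d - x)) • F x) (cψ.smul hF) fun x hx => by
      rw [max_eq_left, zero_smul]
      by_contra! hpos
      refine hx ?_
      rcases pos_and_pos_or_neg_and_neg_of_mul_pos hpos with h | h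
      · exact ⟨by linarith [h.1], by linarith [h.2]⟩
      · linarith [h.1, h.2]
    refine (intervalIntegral.integral_pos hcd
      (Continuous.continuousOn (by fun_prop)) (fun x _ => ?_) ⟨s, ⟨hs.1.le, hs.2.le⟩, ?_⟩).ne' h0
    · rw [inner_smul_right, real_inner_self_eq_norm_sq]
      positivity
    · rw [inner_smul_right, real_inner_self_eq_norm_sq]
      have : 0 < (s - c) * (d - s) := mul_pos (by linarith [hs.1]) (by linarith [hs.2])
      have h2 : 0 < ‖F s‖ := norm_pos_iff.2 hFs
      have h3 : 0 < max 0 ((s - c) * (d - s)) := lt_max_of_lt_right this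
      positivity
  intro s hs
  rw [← closure_Ioo hcd.ne] at hs
  exact closure_minimal hopen (isClosed_eq hF continuous_const) hs

variable [CompleteSpace V]

theorem hasDerivAt_integral_left {f : ℝ → V} (hf : Continuous f) (b t : ℝ) :
    HasDerivAt (fun s => ∫ x in s..b, f x) (-f t) t :=
  integral_hasDerivAt_left (hf.intervalIntegrable _ _)
    hf.stronglyMeasurable.stronglyMeasurableAtFilter hf.continuousAt

theorem hasDerivAt_integral_right {f : ℝ → V} (hf : Continuous f) (a t : ℝ) :
    HasDerivAt (fun s => ∫ x in a..s, f x) (f t) t :=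
  integral_hasDerivAt_right (hf.intervalIntegrable _ _)
    hf.stronglyMeasurable.stronglyMeasurableAtFilter hf.continuousAt

/-- Integration by parts: the primitives from the two end points are adjoint operators. -/
theorem integral_inner_integral_left {α w : ℝ → V} (hα : Continuous α) (hw : Continuous w) (a b : ℝ) :
    ∫ s in a..b, inner ℝ (∫ x in s..b, α x) (w s) =
      ∫ s in a..b, inner ℝ (α s) (∫ x in a..s, w x) := by
  have hP := fun t => hasDerivAt_integral_left hα b t
  have hQ := fun t => hasDerivAt_integral_right hw a t
  have cP : Continuous fun s => ∫ x in s..b, α x :=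
    continuous_iff_continuousAt.2 fun t => (hP t).continuousAt
  have cQ : Continuous fun s => ∫ x in a..s, w x :=
    continuous_iff_continuousAt.2 fun t => (hQ t).continuousAt
  -- The boundary terms vanish: one primitive is zero at `b`, the other at `a`.
  have h := integral_eq_sub_of_hasDerivAt (a := a) (b := b)
    (fun t _ => (hP t).inner ℝ (hQ t)) (Continuous.intervalIntegrable (by fun_prop) _ _)
  rw [intervalIntegral.integral_add (Continuous.intervalIntegrable (by fun_prop) _ _)
    (Continuous.intervalIntegrable (by fun_prop) _ _)] at h
  simp only [integral_same, inner_zero_left, inner_zero_right, sub_zero, inner_neg_left,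
    intervalIntegral.integral_neg] at h
  linarith

/-- Adjoint of the primitive followed by a delay, for a state that vanishes up to time `a`. -/
theorem integral_inner_integral_left_delay {β w h : ℝ → V} (hβ : Continuous β) (hw : Continuous w)
    (hh : Continuous h) {τ : ℝ} (hτ : 0 ≤ τ) (hτ' : τ ≤ b - a)
    (h_zero : ∀ s ≤ a, h s = 0) (h_int : ∀ s ∈ Icc a b, h s = ∫ x in a..s, w x) :
    ∫ s in a..b, inner ℝ (∫ x in (min (s + τ) b)..b, β x) (w s) =
      ∫ s in a..b, inner ℝ (β s) (h (s - τ)) := by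
  have cP : Continuous fun s => ∫ x in s..b, β x :=
    continuous_iff_continuousAt.2 fun t => (hasDerivAt_integral_left hβ b t).continuousAt
  have cP' : Continuous fun s => ∫ x in (min (s + τ) b)..b, β x :=
    cP.comp (by fun_prop : Continuous fun s : ℝ => min (s + τ) b)
  -- Both sides reduce to `[a, b - τ]`: here the inner integral is empty for `s ≥ b - τ`, and in
  -- `hr` the delayed state is zero for `s ≤ a + τ`. What remains is the undelayed identity for `β`
  -- shifted by `τ`.
  have hl : ∫ s in a..b, inner ℝ (∫ x in (min (s + τ) b)..b, β x) (w s) =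
      ∫ s in a..(b - τ), inner ℝ (∫ x in s..(b - τ), β (x + τ)) (w s) := by
    rw [← intervalIntegral.integral_add_adjacent_intervals (b := b - τ)
      (Continuous.intervalIntegrable (by fun_prop) _ _)
      (Continuous.intervalIntegrable (by fun_prop) _ _)]
    have h2 : ∫ s in (b - τ)..b, inner ℝ (∫ x in (min (s + τ) b)..b, β x) (w s) = 0 := by
      rw [intervalIntegral.integral_congr (g := fun _ => (0 : ℝ)), intervalIntegral.integral_zero]
      intro s hs
      rw [uIcc_of_le (by linarith)] at hs
      simp only
      rw [min_eq_right (by linarith [hs.1]), integral_same, inner_zero_left]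
    rw [h2, add_zero]
    refine intervalIntegral.integral_congr fun s hs => ?_
    rw [uIcc_of_le (by linarith)] at hs
    rw [min_eq_left (by linarith [hs.2]), intervalIntegral.integral_comp_add_right,
      sub_add_cancel]
  have hr : ∫ s in a..b, inner ℝ (β s) (h (s - τ)) =
      ∫ s in a..(b - τ), inner ℝ (β (s + τ)) (∫ x in a..s, w x) := by
    rw [← intervalIntegral.integral_add_adjacent_intervals (b := a + τ)
      (Continuous.intervalIntegrable (by fun_prop) _ _)
      (Continuous.intervalIntegrable (by fun_prop) _ _)]
    have h2 : ∫ s in a..(a + τ), inner ℝ (β s) (h (s - τ)) = 0 := by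
      rw [intervalIntegral.integral_congr (g := fun _ => (0 : ℝ)), intervalIntegral.integral_zero]
      intro s hs
      rw [uIcc_of_le (by linarith)] at hs
      simp only
      rw [h_zero _ (by linarith [hs.2]), inner_zero_right]
    have h3 := intervalIntegral.integral_comp_add_right (a := a) (b := b - τ)
      (fun s => inner ℝ (β s) (h (s - τ))) τ
    rw [sub_add_cancel] at h3
    rw [h2, zero_add, ← h3]
    refine intervalIntegral.integral_congr fun s hs => ?_
    rw [uIcc_of_le (by linarith)] at hs
    rw [add_sub_cancel_right, h_int s ⟨hs.1, by linarith [hs.2]⟩]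
  rw [hl, hr, integral_inner_integral_left (by fun_prop) hw]

end Calculus

/-! ### The linearized delay equation. -/

section Linearization

variable {X Y : Type*} [NormedAddCommGroup X] [NormedSpace ℝ X] [NormedAddCommGroup Y]
  [NormedSpace ℝ Y] {a b : ℝ}

/-- The variation of `(q(t), u(t), q(t-τ), u(t-τ))` belonging to a variation `h` of the state and
the variation `v - v(a)` of the control. -/
def variation (hab : a ≤ b) (τ : ℝ) :
    C(Icc a b, X) × C(Icc a b, Y) →L[ℝ] C(Icc a b, X × Y × X × Y) :=
  LinearMap.mkContinuous
    { toFun := fun x => ⟨fun t => (x.1 t, x.2 t - x.2 ⟨a, left_mem_Icc.2 hab⟩,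
        extend hab x.1 (t - τ), extend hab x.2 (t - τ) - x.2 ⟨a, left_mem_Icc.2 hab⟩), by
          have h1 := continuous_extend hab x.1
          have h2 := continuous_extend hab x.2
          fun_prop⟩
      map_add' := fun x y => by
        ext t <;> simp [extend] <;> abel
      map_smul' := fun c x => by
        ext t <;> simp [extend, smul_sub] }
    2 fun x => by
      have h0 : 0 ≤ ‖x‖ := norm_nonneg x
      have h1 : ∀ t, ‖x.1 t‖ ≤ ‖x‖ := fun t => (x.1.norm_coe_le_norm t).trans (norm_fst_le x)
      have h2 : ∀ t, ‖x.2 t‖ ≤ ‖x‖ := fun t => (x.2.norm_coe_le_norm t).trans (norm_snd_le x)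
      have h3 : ∀ s t, ‖x.2 t - x.2 s‖ ≤ 2 * ‖x‖ := fun s t =>
        (norm_sub_le _ _).trans (by linarith [h2 s, h2 t])
      rw [ContinuousMap.norm_le _ (by positivity)]
      intro t
      exact norm_prod_le_iff.2 ⟨(h1 _).trans (by linarith), norm_prod_le_iff.2 ⟨h3 _ _,
        norm_prod_le_iff.2 ⟨(h1 _).trans (by linarith), h3 _ _⟩⟩⟩

theorem variation_apply (hab : a ≤ b) (τ : ℝ) (x : C(Icc a b, X) × C(Icc a b, Y)) (t : Icc a b) :
    variation hab τ x t = (x.1 t, x.2 t - x.2 ⟨a, left_mem_Icc.2 hab⟩,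
        extend hab x.1 (t - τ), extend hab x.2 (t - τ) - x.2 ⟨a, left_mem_Icc.2 hab⟩) := rfl

/-- The linear delay equation has a solution for every inhomogeneity. -/
theorem exists_linear_delay_solution [CompleteSpace X] (hab : a ≤ b) {τ : ℝ} (hτ : 0 ≤ τ)
    (D : C(Icc a b, X × Y × X × Y →L[ℝ] X)) (r : C(Icc a b, X)) :
    ∃ h : C(Icc a b, X), h - primitive hab (pointwise D (variation hab τ (h, 0))) = r := by
  have hint : ∀ (j : ℕ) (t : ℝ), ∫ s in a..t, (s - a) ^ j = (t - a) ^ (j + 1) / (j + 1) := by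
    intro j t
    rw [intervalIntegral.integral_comp_sub_right (fun x => x ^ j), integral_pow]
    simp
  obtain ⟨h, hh⟩ := exists_fixedPoint_of_volterra
    (fun h : C(Icc a b, X) => r + primitive hab (pointwise D (variation hab τ (h, 0))))
    (fun t => t - a) (b - a) ‖D‖ (fun t => sub_nonneg.2 t.2.1)
    (fun t => by linarith [t.2.2]) (norm_nonneg D) (by
      intro w w' M j hM hw t
      have hsub : (r + primitive hab (pointwise D (variation hab τ (w, (0 : C(Icc a b, Y)))))) t -
          (r + primitive hab (pointwise D (variation hab τ (w', (0 : C(Icc a b, Y)))))) t =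
          primitive hab (pointwise D (variation hab τ (w - w', (0 : C(Icc a b, Y))))) t := by
        have : ((w - w', 0) : C(Icc a b, X) × C(Icc a b, Y)) = (w, 0) - (w', 0) := by simp
        rw [this, map_sub, map_sub, map_sub]
        simp
      rw [hsub, primitive_apply, ← hint, ← intervalIntegral.integral_const_mul,
        ← intervalIntegral.integral_const_mul]
      refine intervalIntegral.norm_integral_le_of_norm_le t.2.1 (ae_of_all _ fun s hs => ?_)
        (Continuous.intervalIntegrable (by fun_prop) _ _)
      have hsI : s ∈ Icc a b := ⟨hs.1.le, hs.2.trans t.2.2⟩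
      rw [extend_of_mem hab _ hsI, pointwise_apply]
      refine ((D _).le_opNorm _).trans ?_
      refine mul_le_mul (D.norm_coe_le_norm _) ?_ (norm_nonneg _) (norm_nonneg D)
      have hb : 0 ≤ M * (s - a) ^ j := mul_nonneg hM (pow_nonneg (sub_nonneg.2 hs.1.le) j)
      have h1 : ‖(w - w') ⟨s, hsI⟩‖ ≤ M * (s - a) ^ j := hw ⟨s, hsI⟩
      have h2 : ‖extend hab (w - w') (s - τ)‖ ≤ M * (s - a) ^ j := by
        refine (hw (projIcc a b hab (s - τ))).trans ?_
        -- The delayed argument never exceeds `s`, even after projection to `[a, b]`; this is what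
        -- makes the operator one of Volterra type.
        have h3 : (projIcc a b hab (s - τ) : ℝ) ≤ s := by
          rw [coe_projIcc]
          exact max_le hs.1.le ((min_le_right _ _).trans (by linarith))
        have h4 : a ≤ (projIcc a b hab (s - τ) : ℝ) := (projIcc a b hab (s - τ)).2.1
        gcongr
      rw [variation_apply]
      simp only [Prod.norm_def, sup_le_iff]
      refine ⟨h1, ?_, h2, ?_⟩ <;> simpa [extend] using hb)
  exact ⟨h, sub_eq_iff_eq_add.2 hh.symm⟩

end Linearization

/-! ### The adjoint equation with advanced argument. -/

section Costate

variable {Z V X : Type*} [NormedAddCommGroup Z] [NormedSpace ℝ Z] [NormedAddCommGroup V]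
  [InnerProductSpace ℝ V] [CompleteSpace V] [NormedAddCommGroup X] [InnerProductSpace ℝ X]
  {a b : ℝ}

/-- The linear form `Λ + p · D` of the Hamiltonian along a trajectory. -/
def costateForm (Λ : C(Icc a b, Z →L[ℝ] ℝ)) (D : C(Icc a b, Z →L[ℝ] X)) (p : C(Icc a b, X)) :
    C(Icc a b, Z →L[ℝ] ℝ) :=
  ⟨fun t => Λ t + (innerSL ℝ (p t)).comp (D t), by
    have h := (innerSL ℝ (E := X)).continuous.comp p.continuous
    exact Λ.continuous.add (h.clm_comp D.continuous)⟩

theorem costateForm_apply (Λ : C(Icc a b, Z →L[ℝ] ℝ)) (D : C(Icc a b, Z →L[ℝ] X))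
    (p : C(Icc a b, X)) (t : Icc a b) (z : Z) :
    costateForm Λ D p t z = Λ t z + inner ℝ (p t) (D t z) := rfl

/-- The gradient of a family of linear forms in the directions of `ι`. -/
def formGradient (ι : V →L[ℝ] Z) (l : C(Icc a b, Z →L[ℝ] ℝ)) : C(Icc a b, V) :=
  ⟨fun t => (InnerProductSpace.toDual ℝ V).symm ((l t).comp ι),
    (InnerProductSpace.toDual ℝ V).symm.continuous.comp
      (l.continuous.clm_comp continuous_const)⟩

theorem inner_formGradient (ι : V →L[ℝ] Z) (l : C(Icc a b, Z →L[ℝ] ℝ)) (t : Icc a b) (x : V) :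
    inner ℝ (formGradient ι l t) x = l t (ι x) :=
  InnerProductSpace.toDual_symm_apply

/-- The gradient is affine in `p`, so `Λ` cancels in the difference. This is the Lipschitz bound for
the Volterra estimate. -/
theorem norm_formGradient_costateForm_sub_le (ι : V →L[ℝ] Z) (Λ : C(Icc a b, Z →L[ℝ] ℝ))
    (D : C(Icc a b, Z →L[ℝ] X)) (p p' : C(Icc a b, X)) (t : Icc a b) :
    ‖formGradient ι (costateForm Λ D p) t - formGradient ι (costateForm Λ D p') t‖ ≤
      ‖D‖ * ‖ι‖ * ‖p t - p' t‖ := by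
  have h : formGradient ι (costateForm Λ D p) t - formGradient ι (costateForm Λ D p') t =
      (InnerProductSpace.toDual ℝ V).symm (((innerSL ℝ (p t - p' t)).comp (D t)).comp ι) := by
    change (InnerProductSpace.toDual ℝ V).symm _ - (InnerProductSpace.toDual ℝ V).symm _ = _
    rw [← map_sub]
    congr 1
    ext x
    simp [costateForm_apply]
  rw [h, LinearIsometryEquiv.norm_map]
  have hD : ‖D t‖ ≤ ‖D‖ := D.norm_coe_le_norm t
  calc _ ≤ ‖innerSL ℝ (p t - p' t)‖ * ‖D t‖ * ‖ι‖ :=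
        (ContinuousLinearMap.opNorm_comp_le _ _).trans
          (mul_le_mul_of_nonneg_right (ContinuousLinearMap.opNorm_comp_le _ _) (norm_nonneg _))
    _ ≤ ‖p t - p' t‖ * ‖D‖ * ‖ι‖ := by rw [innerSL_apply_norm]; gcongr
    _ = _ := by ring

/-- The integrated advanced equation of the costate has a solution. -/
theorem exists_costate [CompleteSpace X] (hab : a ≤ b) {τ : ℝ} (hτ : 0 ≤ τ)
    (Λ : C(Icc a b, Z →L[ℝ] ℝ)) (D : C(Icc a b, Z →L[ℝ] X)) (ι κ : X →L[ℝ] Z) :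
    ∃ p : C(Icc a b, X), ∀ t ∈ Icc a b, extend hab p t =
      (∫ s in t..b, extend hab (formGradient ι (costateForm Λ D p)) s) +
        ∫ s in (min (t + τ) b)..b, extend hab (formGradient κ (costateForm Λ D p)) s := by
  have hint : ∀ (j : ℕ) (t : ℝ), ∫ s in t..b, (b - s) ^ j = (b - t) ^ (j + 1) / (j + 1) := by
    intro j t
    rw [intervalIntegral.integral_comp_sub_left (fun x => x ^ j), integral_pow]
    simp
  -- The lower limit is any point of `[t, b]`, so that one estimate serves both `t` and `min (t + τ)
  -- b`: the advanced equation looks only forward and is of Volterra type seen from `b`.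
  have hbound : ∀ (ι : X →L[ℝ] Z) (p p' : C(Icc a b, X)) (M : ℝ) (j : ℕ), 0 ≤ M →
      (∀ s, ‖p s - p' s‖ ≤ M * (b - s) ^ j) → ∀ t ∈ Icc a b, ∀ s ∈ Icc t b,
      ‖(∫ s in s..b, extend hab (formGradient ι (costateForm Λ D p)) s) -
        ∫ s in s..b, extend hab (formGradient ι (costateForm Λ D p')) s‖ ≤
        ‖D‖ * ‖ι‖ * (M * ((b - t) ^ (j + 1) / (j + 1))) := by
    intro ι p p' M j hM hp t ht s hs
    rw [← intervalIntegral.integral_sub ((continuous_extend hab _).intervalIntegrable _ _)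
      ((continuous_extend hab _).intervalIntegrable _ _)]
    have h0 : 0 ≤ b - s := sub_nonneg.2 hs.2
    calc _ ≤ ‖D‖ * ‖ι‖ * (M * ((b - s) ^ (j + 1) / (j + 1))) := by
          rw [← hint, ← intervalIntegral.integral_const_mul, ← intervalIntegral.integral_const_mul]
          refine intervalIntegral.norm_integral_le_of_norm_le hs.2 (ae_of_all _ fun x hx => ?_)
            (Continuous.intervalIntegrable (by fun_prop) _ _)
          have hxI : x ∈ Icc a b := ⟨ht.1.trans (hs.1.trans hx.1.le), hx.2⟩
          rw [extend_of_mem hab _ hxI, extend_of_mem hab _ hxI]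
          refine (norm_formGradient_costateForm_sub_le ι Λ D p p' _).trans ?_
          have := hp ⟨x, hxI⟩
          have hD : 0 ≤ ‖D‖ := norm_nonneg D
          gcongr
      _ ≤ _ := by
          have hD : 0 ≤ ‖D‖ := norm_nonneg D
          have := hs.1
          gcongr
  have hcont : ∀ l : C(Icc a b, X), Continuous fun t : ℝ => ∫ s in t..b, extend hab l s :=
    fun l => continuous_iff_continuousAt.2 fun t =>
      (hasDerivAt_integral_left (continuous_extend hab l) b t).continuousAt
  obtain ⟨p, hp⟩ := exists_fixedPoint_of_volterra
    (fun p : C(Icc a b, X) => (⟨fun t =>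
      (∫ s in t..b, extend hab (formGradient ι (costateForm Λ D p)) s) +
        ∫ s in (min (t + τ) b)..b, extend hab (formGradient κ (costateForm Λ D p)) s,
      ((hcont _).comp continuous_subtype_val).add
        ((hcont _).comp (by fun_prop : Continuous fun t : Icc a b => min ((t : ℝ) + τ) b))⟩ :
      C(Icc a b, X)))
    (fun t => b - t) (b - a) (‖D‖ * ‖ι‖ + ‖D‖ * ‖κ‖) (fun t => sub_nonneg.2 t.2.2)
    (fun t => by linarith [t.2.1])
    (add_nonneg (mul_nonneg (norm_nonneg D) (norm_nonneg _))
      (mul_nonneg (norm_nonneg D) (norm_nonneg _))) (by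
      intro w w' M j hM hw t
      simp only [ContinuousMap.coe_mk]
      rw [add_sub_add_comm, add_mul]
      refine (norm_add_le _ _).trans (add_le_add
        (hbound ι w w' M j hM hw t t.2 t ⟨le_rfl, t.2.2⟩)
        (hbound κ w w' M j hM hw t t.2 _ ⟨le_min (by linarith) t.2.2, min_le_right _ _⟩)))
  refine ⟨p, fun t ht => ?_⟩
  rw [extend_of_mem hab p ht]
  exact (DFunLike.congr_fun hp ⟨t, ht⟩).symm

end Costate

/-! ### Piecewise and global smoothness of the covector. -/

section Regularity

variable {V : Type*} [NormedAddCommGroup V] [InnerProductSpace ℝ V] [CompleteSpace V]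
  {a b τ : ℝ} {p α β : ℝ → V}

/-- Here `t + τ ≤ b`, so the minimum is `t + τ` and both integrals are differentiated in their lower
limits. -/
theorem hasDerivWithinAt_costate_left (hα : Continuous α) (hβ : Continuous β)
    (hp : ∀ t ∈ Icc a b, p t = (∫ s in t..b, α s) + ∫ s in (min (t + τ) b)..b, β s)
    (hτ : 0 ≤ τ) {t : ℝ} (ht : t ∈ Icc a (b - τ)) :
    HasDerivWithinAt p (-α t - β (t + τ)) (Icc a (b - τ)) t := by
  have h1 := hasDerivAt_integral_left hα b t
  have h2 := (hasDerivAt_integral_left hβ b (t + τ)).comp_add_const t τ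
  refine ((h1.add h2).hasDerivWithinAt.congr_deriv (by abel)).congr_of_mem (fun s hs => ?_) ht
  rw [hp s ⟨hs.1, by linarith [hs.2]⟩, min_eq_left (by linarith [hs.2])]
  rfl

/-- Past `b - τ` the advanced integral runs from `b` to `b` and contributes nothing. -/
theorem hasDerivWithinAt_costate_right (hα : Continuous α)
    (hp : ∀ t ∈ Icc a b, p t = (∫ s in t..b, α s) + ∫ s in (min (t + τ) b)..b, β s)
    (hτ : τ ≤ b - a) {t : ℝ} (ht : t ∈ Icc (b - τ) b) :
    HasDerivWithinAt p (-α t) (Icc (b - τ) b) t := by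
  refine (hasDerivAt_integral_left hα b t).hasDerivWithinAt.congr_of_mem (fun s hs => ?_) ht
  rw [hp s ⟨by linarith [hs.1], hs.2⟩, min_eq_right (by linarith [hs.1]), integral_same, add_zero]

/-- When `β` vanishes beyond `b`, the minimum may be replaced by `t + τ`, and one formula with
continuous derivative covers the whole interval. -/
theorem contDiffOn_costate (hab : a < b) (hα : Continuous α) (hβ : Continuous β)
    (hp : ∀ t ∈ Icc a b, p t = (∫ s in t..b, α s) + ∫ s in (min (t + τ) b)..b, β s)
    (hβb : ∀ s, b ≤ s → β s = 0) : ContDiffOn ℝ 1 p (Icc a b) := by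
  refine contDiffOn_one_of_hasDerivWithinAt hab (f' := fun t => -α t - β (t + τ))
    (fun t ht => ?_) (by fun_prop)
  have h1 := hasDerivAt_integral_left hα b t
  have h2 := (hasDerivAt_integral_left hβ b (t + τ)).comp_add_const t τ
  refine ((h1.add h2).hasDerivWithinAt.congr_deriv (by abel)).congr_of_mem (fun s hs => ?_) ht
  rw [hp s hs]
  change _ = (∫ x in s..b, α x) + ∫ x in (s + τ)..b, β x
  congr 1
  rcases le_total (s + τ) b with h | h
  · rw [min_eq_left h]
  · rw [min_eq_right h, integral_same, integral_symm,
      intervalIntegral.integral_congr (g := fun _ => (0 : V)), intervalIntegral.integral_zero,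
      neg_zero]
    intro x hx
    rw [uIcc_of_le h] at hx
    exact hβb x hx.1

end Regularity

/-! ### From the integral identity to pointwise stationarity. -/

section Stationarity

variable {X Y : Type*} [NormedAddCommGroup X] [InnerProductSpace ℝ X]
  [NormedAddCommGroup Y] [InnerProductSpace ℝ Y] {a b : ℝ}

variable (X Y) in
/-- The inclusion of the current state. -/
def inState : X →L[ℝ] X × Y × X × Y := .inl ℝ X (Y × X × Y)

variable (X Y) in
/-- The inclusion of the current control. -/
def inControl : Y →L[ℝ] X × Y × X × Y :=
  (ContinuousLinearMap.inr ℝ X (Y × X × Y)).comp (.inl ℝ Y (X × Y))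

variable (X Y) in
/-- The inclusion of the delayed state. -/
def inDelayedState : X →L[ℝ] X × Y × X × Y :=
  (ContinuousLinearMap.inr ℝ X (Y × X × Y)).comp
    ((ContinuousLinearMap.inr ℝ Y (X × Y)).comp (.inl ℝ X Y))

variable (X Y) in
/-- The inclusion of the delayed control. -/
def inDelayedControl : Y →L[ℝ] X × Y × X × Y :=
  (ContinuousLinearMap.inr ℝ X (Y × X × Y)).comp
    ((ContinuousLinearMap.inr ℝ Y (X × Y)).comp (.inr ℝ X Y))

theorem map_eq_add_inclusions (l : X × Y × X × Y →L[ℝ] ℝ) (x : X) (y : Y) (x' : X) (y' : Y) :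
    l (x, y, x', y') = l (inState X Y x) + l (inControl X Y y) + l (inDelayedState X Y x')
      + l (inDelayedControl X Y y') := by
  rw [← map_add, ← map_add, ← map_add]
  simp [inState, inControl, inDelayedState, inDelayedControl]

/-- The pointwise stationarity conditions on `[a, b - τ]` and on `[b - τ, b]`. -/
theorem stationarity_of_integral_eq_zero (hab : a ≤ b) {τ : ℝ} (hτ : 0 < τ) (hτ' : τ < b - a)
    (γ ε : C(Icc a b, Y))
    (hγε : ∀ v : C(Icc a b, Y), v ⟨a, left_mem_Icc.2 hab⟩ = 0 →
      (∫ s in a..b, inner ℝ (extend hab γ s) (extend hab v s)) +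
        ∫ s in a..b, inner ℝ (extend hab ε s) (extend hab v (s - τ)) = 0) :
    (∀ s ∈ Icc a (b - τ), extend hab γ s + extend hab ε (s + τ) = 0) ∧
      ∀ s ∈ Icc (b - τ) b, extend hab γ s = 0 := by
  have cγ := continuous_extend hab γ
  have cε := continuous_extend hab ε
  have key : ∀ c d : ℝ, a ≤ c → d ≤ b → ∀ v : ℝ → Y, Continuous v →
      (∀ s, s ∉ Ioo c d → v s = 0) →
      (∫ s in a..b, inner ℝ (extend hab γ s) (v s)) +
        ∫ s in (a - τ)..(b - τ), inner ℝ (extend hab ε (s + τ)) (v s) = 0 := by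
    intro c d hc hd v cv hv
    -- The constant extension to the left agrees with `v`, because `v` vanishes there: its support
    -- lies to the right of `c ≥ a`.
    have hext : ∀ s ≤ b, extend hab (⟨fun t => v t, by fun_prop⟩ : C(Icc a b, Y)) s = v s := by
      intro s hs
      rcases le_total a s with h | h
      · rw [extend_of_mem hab _ ⟨h, hs⟩]; rfl
      · rw [extend_of_le hab _ h]
        change v a = v s
        rw [hv a fun hh => by linarith [hh.1], hv s fun hh => by linarith [hh.1]]
    have h := hγε ⟨fun t => v t, by fun_prop⟩ (hv a fun hh => by linarith [hh.1])
    rw [← h]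
    congr 1
    · refine intervalIntegral.integral_congr fun s hs => ?_
      rw [uIcc_of_le hab] at hs
      simp only [hext s hs.2]
    · rw [← intervalIntegral.integral_comp_sub_right
        (fun s => inner ℝ (extend hab ε (s + τ)) (v s)) τ]
      refine intervalIntegral.integral_congr fun s hs => ?_
      rw [uIcc_of_le hab] at hs
      simp only [sub_add_cancel, hext (s - τ) (by linarith [hs.2])]
  have hshrink : ∀ (F v : ℝ → Y) (c d A B : ℝ), A ≤ c → d ≤ B →
      (∀ s, s ∉ Ioo c d → v s = 0) →
      ∫ s in A..B, inner ℝ (F s) (v s) = ∫ s in c..d, inner ℝ (F s) (v s) := by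
    intro F v c d A B hA hB hv
    have hsupp : Function.support (fun s => inner ℝ (F s) (v s)) ⊆ Ioo c d := by
      intro s hs
      by_contra hn
      exact hs (by simp [hv s hn])
    rw [intervalIntegral.integral_eq_integral_of_support_subset,
      intervalIntegral.integral_eq_integral_of_support_subset]
    · exact hsupp.trans Ioo_subset_Ioc_self
    · exact hsupp.trans (Ioo_subset_Ioc_self.trans (Ioc_subset_Ioc hA hB))
  constructor
  -- Test functions living on `(a, b - τ)` see both the current and the shifted delayed term.
  · refine eq_zero_of_forall_integral_inner_eq_zero (by linarith) (by fun_prop) fun v cv hv => ?_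
    have h := key a (b - τ) le_rfl (by linarith) v cv hv
    rw [hshrink _ v a (b - τ) a b le_rfl (by linarith) hv,
      hshrink (fun s => extend hab ε (s + τ)) v a (b - τ) (a - τ) (b - τ) (by linarith) le_rfl hv,
      ← intervalIntegral.integral_add (Continuous.intervalIntegrable (by fun_prop) _ _)
      (Continuous.intervalIntegrable (by fun_prop) _ _)] at h
    simpa only [inner_add_left] using h
  · refine eq_zero_of_forall_integral_inner_eq_zero (by linarith) cγ fun v cv hv => ?_
    have h := key (b - τ) b (by linarith) le_rfl v cv hv
    -- Test functions living on `(b - τ, b)` miss the domain of the shifted delayed term.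
    have h2 : ∫ s in (a - τ)..(b - τ), inner ℝ (extend hab ε (s + τ)) (v s) = 0 := by
      rw [intervalIntegral.integral_congr (g := fun _ => (0 : ℝ)), intervalIntegral.integral_zero]
      intro s hs
      rw [uIcc_of_le (by linarith)] at hs
      simp only
      rw [hv s fun hh => by linarith [hh.1, hs.2], inner_zero_right]
    rwa [h2, add_zero, hshrink _ v (b - τ) b a b (by linarith) le_rfl hv] at h

variable [CompleteSpace X] [CompleteSpace Y]

/-- If the first variation vanishes on all solutions of the linearized delay equation, then the
variation of the Hamiltonian in the control directions vanishes. -/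
theorem integral_control_variation_eq_zero (hab : a ≤ b) {τ : ℝ} (hτ : 0 ≤ τ) (hτ' : τ ≤ b - a)
    (Λ : C(Icc a b, X × Y × X × Y →L[ℝ] ℝ)) (D : C(Icc a b, X × Y × X × Y →L[ℝ] X))
    (p : C(Icc a b, X))
    (hp : ∀ t ∈ Icc a b, extend hab p t =
      (∫ s in t..b, extend hab (formGradient (inState X Y) (costateForm Λ D p)) s) +
        ∫ s in (min (t + τ) b)..b,
          extend hab (formGradient (inDelayedState X Y) (costateForm Λ D p)) s)
    (hΛ : ∀ x : C(Icc a b, X) × C(Icc a b, Y),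
      x.1 - primitive hab (pointwise D (variation hab τ x)) = 0 →
      ∫ s in a..b, extend hab (pointwise Λ (variation hab τ x)) s = 0)
    (v : C(Icc a b, Y)) (hv : v ⟨a, left_mem_Icc.2 hab⟩ = 0) :
    (∫ s in a..b, inner ℝ (extend hab (formGradient (inControl X Y) (costateForm Λ D p)) s)
      (extend hab v s)) +
    ∫ s in a..b, inner ℝ (extend hab (formGradient (inDelayedControl X Y) (costateForm Λ D p)) s)
      (extend hab v (s - τ)) = 0 := by
  -- `h` is the state response to the control variation `v`.
  obtain ⟨h, hh⟩ := exists_linear_delay_solution hab hτ D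
    (primitive hab (pointwise D (variation hab τ ((0 : C(Icc a b, X)), v))))
  set w := pointwise D (variation hab τ (h, v)) with hw
  have hsol : h - primitive hab w = 0 := by
    have : ((h, v) : C(Icc a b, X) × C(Icc a b, Y)) = (h, 0) + (0, v) := by simp
    rw [hw, this, map_add, map_add, map_add, ← hh]
    abel
  have hprim : ∀ s ∈ Icc a b, extend hab h s = ∫ x in a..s, extend hab w x := by
    intro s hs
    rw [extend_of_mem hab h hs, sub_eq_zero.1 hsol, primitive_apply]
  have hzero : ∀ s ≤ a, extend hab h s = 0 := by
    intro s hs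
    rw [extend_of_le hab h hs, ← extend_of_mem hab h (left_mem_Icc.2 hab),
      hprim a (left_mem_Icc.2 hab), integral_same]
  set α := formGradient (inState X Y) (costateForm Λ D p)
  set β := formGradient (inDelayedState X Y) (costateForm Λ D p)
  set γ := formGradient (inControl X Y) (costateForm Λ D p)
  set ε := formGradient (inDelayedControl X Y) (costateForm Λ D p)
  have cα := continuous_extend hab α
  have cβ := continuous_extend hab β
  have cγ := continuous_extend hab γ
  have cε := continuous_extend hab ε
  have ch := continuous_extend hab h
  have cv := continuous_extend hab v
  have cw := continuous_extend hab w
  have cp := continuous_extend hab p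
  have cPα : Continuous fun s => ∫ x in s..b, extend hab α x :=
    continuous_iff_continuousAt.2 fun t => (hasDerivAt_integral_left cα b t).continuousAt
  have cPβ : Continuous fun s => ∫ x in s..b, extend hab β x :=
    continuous_iff_continuousAt.2 fun t => (hasDerivAt_integral_left cβ b t).continuousAt
  have cPβ' : Continuous fun s => ∫ x in (min (s + τ) b)..b, extend hab β x :=
    cPβ.comp (by fun_prop : Continuous fun s : ℝ => min (s + τ) b)
  -- `h` is the primitive of `w` from `a`, and `p` is the adjoint primitive of `α` and of the
  -- advanced `β`.
  have hdual : ∫ s in a..b, inner ℝ (extend hab p s) (extend hab w s) =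
      (∫ s in a..b, inner ℝ (extend hab α s) (extend hab h s)) +
        ∫ s in a..b, inner ℝ (extend hab β s) (extend hab h (s - τ)) := by
    rw [← integral_inner_integral_left_delay cβ cw ch hτ hτ' hzero hprim]
    have h1 : ∫ s in a..b, inner ℝ (extend hab α s) (extend hab h s) =
        ∫ s in a..b, inner ℝ (extend hab α s) (∫ x in a..s, extend hab w x) := by
      refine intervalIntegral.integral_congr fun s hs => ?_
      rw [uIcc_of_le hab] at hs
      simp only [hprim s hs]
    rw [h1, ← integral_inner_integral_left cα cw, ← intervalIntegral.integral_add
      (Continuous.intervalIntegrable (by fun_prop) _ _)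
      (Continuous.intervalIntegrable (by fun_prop) _ _)]
    refine intervalIntegral.integral_congr fun s hs => ?_
    rw [uIcc_of_le hab] at hs
    simp only [hp s hs, inner_add_left]
  -- The form `Λ + p · D` is split along its four slots. By `hdual` the two state terms cancel the
  -- pairing of `p` with `w`, leaving only the control terms.
  have hsplit : (∫ s in a..b, extend hab (pointwise Λ (variation hab τ (h, v))) s) +
      ∫ s in a..b, inner ℝ (extend hab p s) (extend hab w s) =
      (∫ s in a..b, inner ℝ (extend hab α s) (extend hab h s)) +
      (∫ s in a..b, inner ℝ (extend hab γ s) (extend hab v s)) +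
      (∫ s in a..b, inner ℝ (extend hab β s) (extend hab h (s - τ))) +
      ∫ s in a..b, inner ℝ (extend hab ε s) (extend hab v (s - τ)) := by
    rw [← intervalIntegral.integral_add ((continuous_extend hab _).intervalIntegrable _ _)
      (Continuous.intervalIntegrable (by fun_prop) _ _),
      ← intervalIntegral.integral_add (Continuous.intervalIntegrable (by fun_prop) _ _)
      (Continuous.intervalIntegrable (by fun_prop) _ _),
      ← intervalIntegral.integral_add (Continuous.intervalIntegrable (by fun_prop) _ _)
      (Continuous.intervalIntegrable (by fun_prop) _ _),
      ← intervalIntegral.integral_add (Continuous.intervalIntegrable (by fun_prop) _ _)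
      (Continuous.intervalIntegrable (by fun_prop) _ _)]
    refine intervalIntegral.integral_congr fun s hs => ?_
    rw [uIcc_of_le hab] at hs
    simp only [extend_of_mem hab _ hs, hw, pointwise_apply]
    rw [← costateForm_apply, variation_apply]
    simp only [hv, sub_zero]
    rw [map_eq_add_inclusions]
    simp only [α, β, γ, ε, inner_formGradient]
  rw [hΛ (h, v) hsol, hdual] at hsplit
  linarith

end Stationarity

/-! ### The Hamiltonian along a trajectory. -/

section Trajectory

variable {n m k : ℕ} {a b : ℝ}

/-- The curve `(q(t), u(t), q(t-τ), u(t-τ))` on `[a, b]`. -/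
def delayPath {τ : ℝ} (hτ : 0 ≤ τ) {q : ℝ → E n} {u : ℝ → E m}
    (hq : ContinuousOn q (Icc (a - τ) b)) (hu : ContinuousOn u (Icc (a - τ) b)) :
    C(Icc a b, E n × E m × E n × E m) :=
  ⟨fun t => (q t, u t, q (t - τ), u (t - τ)), by
    have h1 : ∀ t : Icc a b, (t : ℝ) ∈ Icc (a - τ) b := fun t => ⟨by linarith [t.2.1], t.2.2⟩
    have h2 : ∀ t : Icc a b, (t : ℝ) - τ ∈ Icc (a - τ) b := fun t =>
      ⟨by linarith [t.2.1], by linarith [t.2.2]⟩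
    exact (hq.comp_continuous (by fun_prop) h1).prodMk ((hu.comp_continuous (by fun_prop) h1).prodMk
      ((hq.comp_continuous (by fun_prop) h2).prodMk (hu.comp_continuous (by fun_prop) h2)))⟩

namespace Problem

variable (P : Problem n m k)

/-- The derivative of the Hamiltonian in its second to fifth argument. -/
def hamiltonianDeriv (x : Pt n m) (r : E n) (lam : E k) : E n × E m × E n × E m →L[ℝ] ℝ :=
  sliceDeriv P.L x - (innerSL ℝ lam).comp (sliceDeriv P.g x) + (innerSL ℝ r).comp (sliceDeriv P.φ x)

variable {P}

theorem hasFDerivAt_hamiltonian (hL : ContDiffOn ℝ 1 P.L (Icc P.t₁ P.t₂ ×ˢ univ))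
    (hg : ContDiffOn ℝ 1 P.g (Icc P.t₁ P.t₂ ×ˢ univ))
    (hφ : ContDiffOn ℝ 1 P.φ (Icc P.t₁ P.t₂ ×ˢ univ)) {t : ℝ} (ht : t ∈ Icc P.t₁ P.t₂)
    (y : E n × E m × E n × E m) (r : E n) (lam : E k) :
    HasFDerivAt (fun y => P.hamiltonian (t, y) r lam) (P.hamiltonianDeriv (t, y) r lam) y := by
  have h1 := hasFDerivAt_sliceDeriv hL ht y
  have h2 := (innerSL ℝ lam).hasFDerivAt.comp y (hasFDerivAt_sliceDeriv hg ht y)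
  have h3 := (innerSL ℝ r).hasFDerivAt.comp y (hasFDerivAt_sliceDeriv hφ ht y)
  exact (h1.sub h2).add h3

/-- Chain rule through the affine embedding of one slot, followed by Riesz representation. -/
theorem gradients_hamiltonian (hL : ContDiffOn ℝ 1 P.L (Icc P.t₁ P.t₂ ×ˢ univ))
    (hg : ContDiffOn ℝ 1 P.g (Icc P.t₁ P.t₂ ×ˢ univ))
    (hφ : ContDiffOn ℝ 1 P.φ (Icc P.t₁ P.t₂ ×ˢ univ)) {x : Pt n m} (hx : x.1 ∈ Icc P.t₁ P.t₂)
    (r : E n) (lam : E k) :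
    d₂ P.hamiltonian x r lam = (InnerProductSpace.toDual ℝ (E n)).symm
        ((P.hamiltonianDeriv x r lam).comp (inState (E n) (E m))) ∧
      d₃ P.hamiltonian x r lam = (InnerProductSpace.toDual ℝ (E m)).symm
        ((P.hamiltonianDeriv x r lam).comp (inControl (E n) (E m))) ∧
      d₄ P.hamiltonian x r lam = (InnerProductSpace.toDual ℝ (E n)).symm
        ((P.hamiltonianDeriv x r lam).comp (inDelayedState (E n) (E m))) ∧
      d₅ P.hamiltonian x r lam = (InnerProductSpace.toDual ℝ (E m)).symm
        ((P.hamiltonianDeriv x r lam).comp (inDelayedControl (E n) (E m))) := by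
  obtain ⟨t, y₁, y₂, y₃, y₄⟩ := x
  have h := hasFDerivAt_hamiltonian hL hg hφ hx (y₁, y₂, y₃, y₄) r lam
  refine ⟨congrArg _ (HasFDerivAt.fderiv ?_), congrArg _ (HasFDerivAt.fderiv ?_),
    congrArg _ (HasFDerivAt.fderiv ?_), congrArg _ (HasFDerivAt.fderiv ?_)⟩
  · exact h.comp (f := fun x => (x, y₂, y₃, y₄)) y₁ (hasFDerivAt_prodMk_left y₁ _)
  · exact h.comp (f := fun x => (y₁, x, y₃, y₄)) y₂
      ((hasFDerivAt_prodMk_right y₁ (y₂, y₃, y₄)).comp y₂ (hasFDerivAt_prodMk_left y₂ _))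
  · exact h.comp (f := fun x => (y₁, y₂, x, y₄)) y₃
      ((hasFDerivAt_prodMk_right y₁ (y₂, y₃, y₄)).comp y₃
        ((hasFDerivAt_prodMk_right y₂ (y₃, y₄)).comp y₃ (hasFDerivAt_prodMk_left y₃ _)))
  · exact h.comp (f := fun x => (y₁, y₂, y₃, x)) y₄
      ((hasFDerivAt_prodMk_right y₁ (y₂, y₃, y₄)).comp y₄
        ((hasFDerivAt_prodMk_right y₂ (y₃, y₄)).comp y₄ (hasFDerivAt_prodMk_right y₃ _)))

/-- The Hamiltonian is affine in the covector, so the state equation of the Hamiltonian system is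
just the original dynamics. -/
theorem d₆_hamiltonian (x : Pt n m) (r : E n) (lam : E k) :
    d₆ P.hamiltonian x r lam = P.φ x := by
  have h : HasGradientAt (fun r => P.hamiltonian x r lam) (P.φ x) r := by
    rw [hasGradientAt_iff_hasFDerivAt]
    have h1 := ((hasFDerivAt_id r).inner ℝ (hasFDerivAt_const (P.φ x) r)).const_add
      (P.L x - inner ℝ lam (P.g x))
    refine h1.congr_fderiv ?_
    ext y
    simp [fderivInnerCLM_apply, real_inner_comm]
  exact h.gradient

/-- Multipliers that annihilate the first variation along the linearized delay equation come from
an extremal whose covector vanishes at the free end point. -/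
theorem exists_isPontryaginExtremal (ht : P.t₁ < P.t₂) (hτ : 0 < P.τ) (hτ' : P.τ < P.t₂ - P.t₁)
    (hL : ContDiffOn ℝ 1 P.L (Icc P.t₁ P.t₂ ×ˢ univ))
    (hg : ContDiffOn ℝ 1 P.g (Icc P.t₁ P.t₂ ×ˢ univ))
    (hφ : ContDiffOn ℝ 1 P.φ (Icc P.t₁ P.t₂ ×ˢ univ)) {q : ℝ → E n} {u : ℝ → E m}
    (hadm : P.IsAdmissible q u) (z : C(Icc P.t₁ P.t₂, E n × E m × E n × E m))
    (hz : ∀ t : Icc P.t₁ P.t₂, delayPt P.τ q u t = (↑t, z t)) (lam : E k)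
    (hstat : ∀ x : C(Icc P.t₁ P.t₂, E n) × C(Icc P.t₁ P.t₂, E m),
      x.1 - primitive ht.le (pointwise (nemytskii _ (continuousOn_sliceDeriv ht hφ) z)
        (variation ht.le P.τ x)) = 0 →
      primitive ht.le (pointwise (nemytskii _ (continuousOn_sliceDeriv ht hL) z)
        (variation ht.le P.τ x)) ⟨P.t₂, right_mem_Icc.2 ht.le⟩ -
      inner ℝ lam (primitive ht.le (pointwise (nemytskii _ (continuousOn_sliceDeriv ht hg) z)
        (variation ht.le P.τ x)) ⟨P.t₂, right_mem_Icc.2 ht.le⟩) = 0) :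
    ∃ p : ℝ → E n, p P.t₂ = 0 ∧ P.IsPontryaginExtremal q u p lam ∧
      (d₄ P.hamiltonian (delayPt P.τ q u P.t₂) (p P.t₂) lam = 0 →
        ContDiffOn ℝ 1 p (Icc P.t₁ P.t₂)) := by
  set DL := nemytskii _ (continuousOn_sliceDeriv ht hL) z with hDL
  set Dg := nemytskii _ (continuousOn_sliceDeriv ht hg) z with hDg
  set Dφ := nemytskii _ (continuousOn_sliceDeriv ht hφ) z with hDφ
  let Λ : C(Icc P.t₁ P.t₂, E n × E m × E n × E m →L[ℝ] ℝ) :=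
    ⟨fun t => DL t - (innerSL ℝ lam).comp (Dg t),
      DL.continuous.sub (continuous_const.clm_comp Dg.continuous)⟩
  have hΛ : ∀ x : C(Icc P.t₁ P.t₂, E n) × C(Icc P.t₁ P.t₂, E m),
      x.1 - primitive ht.le (pointwise Dφ (variation ht.le P.τ x)) = 0 →
      ∫ s in P.t₁..P.t₂, extend ht.le (pointwise Λ (variation ht.le P.τ x)) s = 0 := by
    intro x hx
    rw [← hstat x hx, primitive_apply, primitive_apply]
    have h1 := ContinuousLinearMap.intervalIntegral_comp_comm (innerSL ℝ lam)
      ((continuous_extend ht.le (pointwise Dg (variation ht.le P.τ x))).intervalIntegrable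
        (μ := volume) P.t₁ P.t₂)
    simp only [innerSL_apply_apply] at h1
    rw [← h1, ← intervalIntegral.integral_sub ((continuous_extend ht.le _).intervalIntegrable _ _)
      (Continuous.intervalIntegrable
        (continuous_const.inner (continuous_extend ht.le _)) _ _)]
    rfl
  obtain ⟨p, hp⟩ := exists_costate ht.le hτ.le Λ Dφ (inState (E n) (E m))
    (inDelayedState (E n) (E m))
  have hst := stationarity_of_integral_eq_zero ht.le hτ hτ' _ _
    (integral_control_variation_eq_zero ht.le hτ.le hτ'.le Λ Dφ p hp hΛ)
  set α := formGradient (inState (E n) (E m)) (costateForm Λ Dφ p)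
  set β := formGradient (inDelayedState (E n) (E m)) (costateForm Λ Dφ p)
  set γ := formGradient (inControl (E n) (E m)) (costateForm Λ Dφ p)
  set ε := formGradient (inDelayedControl (E n) (E m)) (costateForm Λ Dφ p)
  -- With this `Λ`, the form driving the costate is by definition the derivative of the Hamiltonian,
  -- so `α`, `β`, `γ`, `ε` are its partial gradients.
  have hform : ∀ t : Icc P.t₁ P.t₂, P.hamiltonianDeriv (t, z t) (p t) lam = costateForm Λ Dφ p t :=
    fun t => rfl
  have hgrad : ∀ t ∈ Icc P.t₁ P.t₂,
      d₂ P.hamiltonian (delayPt P.τ q u t) (extend ht.le p t) lam = extend ht.le α t ∧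
      d₃ P.hamiltonian (delayPt P.τ q u t) (extend ht.le p t) lam = extend ht.le γ t ∧
      d₄ P.hamiltonian (delayPt P.τ q u t) (extend ht.le p t) lam = extend ht.le β t ∧
      d₅ P.hamiltonian (delayPt P.τ q u t) (extend ht.le p t) lam = extend ht.le ε t := by
    intro t htI
    have h := gradients_hamiltonian hL hg hφ (x := delayPt P.τ q u t) htI (extend ht.le p t) lam
    have hzt : delayPt P.τ q u t = (t, z ⟨t, htI⟩) := hz ⟨t, htI⟩
    simp only [extend_of_mem ht.le _ htI, hzt] at h ⊢
    rw [hform ⟨t, htI⟩] at h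
    exact h
  have hmemL : ∀ t ∈ Icc P.t₁ (P.t₂ - P.τ), t ∈ Icc P.t₁ P.t₂ := fun t h =>
    ⟨h.1, by linarith [h.2]⟩
  have hmemL' : ∀ t ∈ Icc P.t₁ (P.t₂ - P.τ), t + P.τ ∈ Icc P.t₁ P.t₂ := fun t h =>
    ⟨by linarith [h.1], by linarith [h.2]⟩
  have hmemR : ∀ t ∈ Icc (P.t₂ - P.τ) P.t₂, t ∈ Icc P.t₁ P.t₂ := fun t h =>
    ⟨by linarith [h.1], h.2⟩
  have cα := continuous_extend ht.le α
  have cβ := continuous_extend ht.le β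
  have hleft := fun t (h : t ∈ Icc P.t₁ (P.t₂ - P.τ)) =>
    hasDerivWithinAt_costate_left cα cβ hp hτ.le h
  have hright := fun t (h : t ∈ Icc (P.t₂ - P.τ) P.t₂) =>
    hasDerivWithinAt_costate_right cα hp hτ'.le h
  have hpb : extend ht.le p P.t₂ = 0 := by
    rw [hp P.t₂ (right_mem_Icc.2 ht.le), min_eq_right (by linarith)]
    simp
  refine ⟨extend ht.le p, hpb, ⟨?_, ?_, ?_, ?_, ?_, ?_, ?_⟩, ?_⟩
  · exact contDiffOn_one_of_hasDerivWithinAt (by linarith) hleft (by fun_prop)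
  · exact contDiffOn_one_of_hasDerivWithinAt (by linarith) hright (by fun_prop)
  · intro t h
    rw [d₆_hamiltonian]
    exact hadm.dynamics t h
  · intro t h
    rw [(hgrad t (hmemL t h)).1, (hgrad _ (hmemL' t h)).2.2.1]
    exact hleft t h
  · intro t h
    rw [(hgrad t (hmemR t h)).1]
    exact hright t h
  · intro t h
    rw [(hgrad t (hmemL t h)).2.1, (hgrad _ (hmemL' t h)).2.2.2]
    exact hst.1 t h
  · intro t h
    rw [(hgrad t (hmemR t h)).2.1]
    exact hst.2 t h
  · intro h0
    rw [(hgrad _ (right_mem_Icc.2 ht.le)).2.2.1] at h0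
    -- Beyond `t₂` the extended `β` keeps its value at `t₂`, which is zero by assumption.
    refine contDiffOn_costate ht cα cβ hp fun s hs => ?_
    rw [← h0, extend, extend, projIcc_of_right_le ht.le hs, projIcc_right]

end Problem

end Trajectory

/-! ### Admissible variations and Lagrange multipliers. -/

namespace Problem

variable {n m k : ℕ} {P : Problem n m k}

/-- A solution of the integrated equation for the variation gives an admissible pair. -/
theorem isAdmissible_add_variation (ht : P.t₁ < P.t₂) (hτ : 0 < P.τ)
    (hg : ContinuousOn P.g (Icc P.t₁ P.t₂ ×ˢ univ))
    (hφ : ContinuousOn P.φ (Icc P.t₁ P.t₂ ×ˢ univ)) {q : ℝ → E n} {u : ℝ → E m}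
    (hadm : P.IsAdmissible q u) (z : C(Icc P.t₁ P.t₂, E n × E m × E n × E m))
    (hz : ∀ t : Icc P.t₁ P.t₂, delayPt P.τ q u t = (↑t, z t))
    (x : C(Icc P.t₁ P.t₂, E n) × C(Icc P.t₁ P.t₂, E m)) (q' : ℝ → E n) (u' : ℝ → E m)
    (hq' : ∀ t, q' t = q t + extend ht.le x.1 t)
    (hu' : ∀ t, u' t = u t + (extend ht.le x.2 t - x.2 ⟨P.t₁, left_mem_Icc.2 ht.le⟩))
    (hz' : ∀ t : Icc P.t₁ P.t₂,
      delayPt P.τ q' u' t = (↑t, (z + variation ht.le P.τ x) t))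
    (hstate : x.1 = primitive ht.le
      (nemytskii P.φ hφ (z + variation ht.le P.τ x) - nemytskii P.φ hφ z))
    (hiso : primitive ht.le (nemytskii P.g hg (z + variation ht.le P.τ x))
      ⟨P.t₂, right_mem_Icc.2 ht.le⟩ = P.l) : P.IsAdmissible q' u' := by
  set w := nemytskii P.φ hφ (z + variation ht.le P.τ x) - nemytskii P.φ hφ z with hw
  have hx0 : x.1 ⟨P.t₁, left_mem_Icc.2 ht.le⟩ = 0 := by
    rw [hstate, primitive_apply, integral_same]
  have hvar0 : variation ht.le P.τ x ⟨P.t₁, left_mem_Icc.2 ht.le⟩ = 0 := by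
    rw [variation_apply, extend_of_le ht.le _ (by simp only; linarith),
      extend_of_le ht.le _ (by simp only; linarith)]
    simp [hx0]
  -- State and control variations both vanish at `t₁`, so the velocity of `h` starts from zero.
  -- Extending `h` by zero to the left therefore keeps the state `C¹` across `t₁`.
  have hw0 : ∀ s ≤ P.t₁, extend ht.le w s = 0 := by
    intro s hs
    rw [extend_of_le ht.le _ hs]
    change P.φ (P.t₁, z _ + variation ht.le P.τ x _) - P.φ (P.t₁, z _) = 0
    rw [hvar0, add_zero, sub_self]
  have hext : ∀ t ≤ P.t₂, extend ht.le x.1 t = ∫ s in P.t₁..t, extend ht.le w s := by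
    intro t h
    rcases le_total P.t₁ t with h1 | h1
    · rw [extend_of_mem ht.le _ ⟨h1, h⟩, hstate, primitive_apply]
    · rw [extend_of_le ht.le _ h1, hx0, integral_symm,
        intervalIntegral.integral_congr (g := fun _ => (0 : E n)), intervalIntegral.integral_zero,
        neg_zero]
      intro s hs
      rw [uIcc_of_le h1] at hs
      exact hw0 s hs.2
  have hderiv : ∀ t ∈ Icc (P.t₁ - P.τ) P.t₂,
      HasDerivWithinAt (extend ht.le x.1) (extend ht.le w t) (Icc (P.t₁ - P.τ) P.t₂) t :=
    fun t h => (hasDerivAt_integral_right (continuous_extend ht.le w) P.t₁ t).hasDerivWithinAt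
      |>.congr_of_mem (fun s hs => hext s hs.2) h
  have hq'' : q' = fun t => q t + extend ht.le x.1 t := funext hq'
  have hu'' : u' = fun t => u t + (extend ht.le x.2 t - x.2 ⟨P.t₁, left_mem_Icc.2 ht.le⟩) :=
    funext hu'
  constructor
  · rw [hq'']
    exact hadm.state_C1.add (contDiffOn_one_of_hasDerivWithinAt (by linarith) hderiv
      (continuous_extend ht.le w).continuousOn)
  · rw [hu'']
    exact hadm.control_C0.add
      ((continuous_extend ht.le x.2).sub continuous_const).continuousOn
  · intro t h
    have h1 := (hadm.dynamics t h).add (hderiv t ⟨by linarith [h.1], h.2⟩)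
    rw [hq'']
    refine h1.congr_deriv ?_
    rw [extend_of_mem ht.le _ h]
    have e1 : delayPt P.τ q u t = (t, z ⟨t, h⟩) := hz ⟨t, h⟩
    have e2 : delayPt P.τ q' u' t = (t, (z + variation ht.le P.τ x) ⟨t, h⟩) := hz' ⟨t, h⟩
    rw [← hq'', e1, e2]
    exact add_sub_cancel _ _
  · rw [← hiso, primitive_apply]
    refine intervalIntegral.integral_congr fun t h => ?_
    rw [uIcc_of_le ht.le] at h
    have e2 : delayPt P.τ q' u' t = (t, (z + variation ht.le P.τ x) ⟨t, h⟩) := hz' ⟨t, h⟩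
    simp only [e2, extend_of_mem ht.le _ h]
    rfl
  · intro t h
    rw [hq', extend_of_le ht.le _ h.2, hx0, add_zero]
    exact hadm.initial t h

/-- Lagrange multipliers for the first variation at a local minimizer. -/
theorem exists_multipliers (ht : P.t₁ < P.t₂) (hτ : 0 < P.τ)
    (hL : ContDiffOn ℝ 1 P.L (Icc P.t₁ P.t₂ ×ˢ univ))
    (hg : ContDiffOn ℝ 1 P.g (Icc P.t₁ P.t₂ ×ˢ univ))
    (hφ : ContDiffOn ℝ 1 P.φ (Icc P.t₁ P.t₂ ×ˢ univ)) {q : ℝ → E n} {u : ℝ → E m}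
    (hmin : P.IsLocalMinimizer q u) (z : C(Icc P.t₁ P.t₂, E n × E m × E n × E m))
    (hz : ∀ t : Icc P.t₁ P.t₂, delayPt P.τ q u t = (↑t, z t)) :
    ∃ (c : ℝ) (mu : E k), (c ≠ 0 ∨ mu ≠ 0) ∧
      ∀ x : C(Icc P.t₁ P.t₂, E n) × C(Icc P.t₁ P.t₂, E m),
      x.1 - primitive ht.le (pointwise (nemytskii _ (continuousOn_sliceDeriv ht hφ) z)
        (variation ht.le P.τ x)) = 0 →
      c * primitive ht.le (pointwise (nemytskii _ (continuousOn_sliceDeriv ht hL) z)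
        (variation ht.le P.τ x)) ⟨P.t₂, right_mem_Icc.2 ht.le⟩ +
      inner ℝ mu (primitive ht.le (pointwise (nemytskii _ (continuousOn_sliceDeriv ht hg) z)
        (variation ht.le P.τ x)) ⟨P.t₂, right_mem_Icc.2 ht.le⟩) = 0 := by
  set T : Icc P.t₁ P.t₂ := ⟨P.t₂, right_mem_Icc.2 ht.le⟩
  let S := variation (X := E n) (Y := E m) ht.le P.τ
  have hS : HasStrictFDerivAt (fun x => z + S x) S 0 := S.hasStrictFDerivAt.const_add z
  have hS0 : z + S 0 = z := by rw [map_zero, add_zero]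
  have hN : ∀ {W : Type} [NormedAddCommGroup W] [NormedSpace ℝ W]
      {f : ℝ × E n × E m × E n × E m → W} (hf : ContDiffOn ℝ 1 f (Icc P.t₁ P.t₂ ×ˢ univ)),
      HasStrictFDerivAt (fun x => primitive ht.le (nemytskii f hf.continuousOn (z + S x)))
        ((primitive ht.le).comp
          ((pointwise (nemytskii _ (continuousOn_sliceDeriv ht hf) z)).comp S)) 0 := by
    intro W _ _ f hf
    have h := hasStrictFDerivAt_nemytskii ht hf (z + S 0)
    have h2 := (primitive (W := W) ht.le).hasStrictFDerivAt.comp 0 (h.comp 0 hS)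
    rw [hS0] at h2
    exact h2
  let ev : ∀ (W : Type) [NormedAddCommGroup W] [NormedSpace ℝ W], C(Icc P.t₁ P.t₂, W) →L[ℝ] W :=
    fun W _ _ => ContinuousMap.evalCLM ℝ T
  -- Subtracting the primitive for `z` turns the integrated dynamics of the varied pair into an
  -- equation for `h` alone; it also forces `h` to vanish at `t₁`.
  let F : C(Icc P.t₁ P.t₂, E n) × C(Icc P.t₁ P.t₂, E m) → C(Icc P.t₁ P.t₂, E n) × E k := fun x =>
    (x.1 - (primitive ht.le (nemytskii P.φ hφ.continuousOn (z + S x)) -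
        primitive ht.le (nemytskii P.φ hφ.continuousOn z)),
      ev (E k) (primitive ht.le (nemytskii P.g hg.continuousOn (z + S x))))
  let J : C(Icc P.t₁ P.t₂, E n) × C(Icc P.t₁ P.t₂, E m) → ℝ := fun x =>
    ev ℝ (primitive ht.le (nemytskii P.L hL.continuousOn (z + S x)))
  have hF := (((ContinuousLinearMap.fst ℝ C(Icc P.t₁ P.t₂, E n)
    C(Icc P.t₁ P.t₂, E m)).hasStrictFDerivAt (x := 0)).sub ((hN hφ).sub_const
      (primitive ht.le (nemytskii P.φ hφ.continuousOn z)))).prodMk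
    ((ev (E k)).hasStrictFDerivAt.comp 0 (hN hg))
  have hJ := (ev ℝ).hasStrictFDerivAt.comp 0 (hN hL)
  have hF0 : F 0 = (0, P.l) := by
    refine Prod.ext ?_ ?_
    · simp [F]
    · rw [← hmin.1.isoperimetric]
      change primitive ht.le (nemytskii P.g hg.continuousOn (z + S 0)) T = _
      rw [hS0, primitive_apply]
      refine intervalIntegral.integral_congr fun t h => ?_
      rw [uIcc_of_le ht.le] at h
      have e : delayPt P.τ q u t = (t, z ⟨t, h⟩) := hz ⟨t, h⟩
      simp only [e, extend_of_mem ht.le _ h]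
      rfl
  have hext : IsLocalExtrOn J {x | F x = F 0} 0 := by
    left
    obtain ⟨hadm, ε, hε, hle⟩ := hmin
    -- Half of `ε`, since the control changes by `v - v(t₁)`, whose norm is only bounded by `2 *
    -- ‖x‖`.
    have hball : ∀ᶠ x : C(Icc P.t₁ P.t₂, E n) × C(Icc P.t₁ P.t₂, E m) in
        𝓝[{x | F x = F 0}] 0, ‖x‖ < ε / 2 := by
      refine nhdsWithin_le_nhds ?_
      filter_upwards [Metric.ball_mem_nhds (0 : C(Icc P.t₁ P.t₂, E n) × C(Icc P.t₁ P.t₂, E m))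
        (half_pos hε)] with x hx
      simpa using hx
    filter_upwards [hball, self_mem_nhdsWithin] with x hx hFx
    rw [hF0] at hFx
    have hF1 : x.1 - (primitive ht.le (nemytskii P.φ hφ.continuousOn (z + S x)) -
        primitive ht.le (nemytskii P.φ hφ.continuousOn z)) = 0 := congrArg Prod.fst hFx
    have hF2 : primitive ht.le (nemytskii P.g hg.continuousOn (z + S x)) T = P.l :=
      congrArg Prod.snd hFx
    let q' : ℝ → E n := fun t => q t + extend ht.le x.1 t
    let u' : ℝ → E m := fun t =>
      u t + (extend ht.le x.2 t - x.2 ⟨P.t₁, left_mem_Icc.2 ht.le⟩)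
    have hz' : ∀ t : Icc P.t₁ P.t₂, delayPt P.τ q' u' t = (↑t, (z + S x) t) := by
      intro t
      have h1 : z t = (q t, u t, q (t - P.τ), u (t - P.τ)) := (congrArg Prod.snd (hz t)).symm
      rw [ContinuousMap.add_apply, h1, variation_apply]
      simp only [delayPt, q', u', extend_coe, Prod.mk_add_mk]
    have hadm' := isAdmissible_add_variation ht hτ hg.continuousOn hφ.continuousOn hadm z hz x q' u'
      (fun _ => rfl) (fun _ => rfl) hz' (by rw [map_sub]; exact sub_eq_zero.1 hF1) hF2
    have hcost : ∀ (q : ℝ → E n) (u : ℝ → E m) (z : C(Icc P.t₁ P.t₂, E n × E m × E n × E m)),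
        (∀ t : Icc P.t₁ P.t₂, delayPt P.τ q u t = (↑t, z t)) →
        primitive ht.le (nemytskii P.L hL.continuousOn z) T = P.cost q u := by
      intro q u z hz
      rw [primitive_apply, cost]
      refine intervalIntegral.integral_congr fun t h => ?_
      rw [uIcc_of_le ht.le] at h
      have e : delayPt P.τ q u t = (t, z ⟨t, h⟩) := hz ⟨t, h⟩
      simp only [e, extend_of_mem ht.le _ h]
      rfl
    change primitive ht.le (nemytskii P.L hL.continuousOn (z + S 0)) T ≤
      primitive ht.le (nemytskii P.L hL.continuousOn (z + S x)) T
    rw [hS0, hcost q u z hz, hcost q' u' _ hz']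
    refine hle q' u' hadm' fun t _ => ?_
    have h1 : ∀ s, ‖x.1 s‖ ≤ ‖x‖ := fun s => (x.1.norm_coe_le_norm s).trans (norm_fst_le x)
    have h2 : ∀ s, ‖x.2 s‖ ≤ ‖x‖ := fun s => (x.2.norm_coe_le_norm s).trans (norm_snd_le x)
    simp only [q', u', add_sub_cancel_left]
    refine ⟨((h1 _).trans_lt hx).trans (by linarith), ?_⟩
    refine (norm_sub_le _ _).trans_lt ?_
    have h3 := h2 (projIcc P.t₁ P.t₂ ht.le t)
    have h4 := h2 ⟨P.t₁, left_mem_Icc.2 ht.le⟩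
    simp only [extend]
    linarith
  obtain ⟨Φ, c, hne, hΦ⟩ := hext.exists_linear_map_of_hasStrictFDerivAt hF hJ
  -- `Φ` is merely a linear functional, but its restriction to the finite-dimensional factor is
  -- continuous and has a Riesz representative.
  let ψ : E k →L[ℝ] ℝ := LinearMap.toContinuousLinearMap
    (Φ.comp (LinearMap.inr ℝ C(Icc P.t₁ P.t₂, E n) (E k)))
  have hψ : ∀ y, inner ℝ ((InnerProductSpace.toDual ℝ (E k)).symm ψ) y = Φ (0, y) := fun y =>
    InnerProductSpace.toDual_symm_apply
  have hid : ∀ x : C(Icc P.t₁ P.t₂, E n) × C(Icc P.t₁ P.t₂, E m),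
      Φ (x.1 - primitive ht.le (pointwise (nemytskii _ (continuousOn_sliceDeriv ht hφ) z) (S x)),
        primitive ht.le (pointwise (nemytskii _ (continuousOn_sliceDeriv ht hg) z) (S x)) T) +
      c * primitive ht.le (pointwise (nemytskii _ (continuousOn_sliceDeriv ht hL) z) (S x)) T
        = 0 := fun x => hΦ x
  refine ⟨c, (InnerProductSpace.toDual ℝ (E k)).symm ψ, ?_, fun x hx => ?_⟩
  · by_contra! h0
    obtain ⟨hc, hmu⟩ := h0
    have hΦ2 : ∀ y, Φ (0, y) = 0 := fun y => by rw [← hψ, hmu, inner_zero_left]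
    refine hne (Prod.ext (LinearMap.ext fun y => ?_) hc)
    -- Every `y` differs from the linearized constraint at some `(h, 0)` by an element of `0 × ℝᵏ`.
    -- With `c = 0` and `mu = 0`, `Φ` kills both parts, contradicting nontriviality.
    obtain ⟨h, hh⟩ := exists_linear_delay_solution (Y := E m) ht.le hτ.le
      (nemytskii _ (continuousOn_sliceDeriv ht hφ) z) y.1
    have h1 := hid (h, 0)
    rw [hc, zero_mul, add_zero, hh] at h1
    have h2 : y = (y.1, primitive ht.le
        (pointwise (nemytskii _ (continuousOn_sliceDeriv ht hg) z) (S (h, 0))) T) +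
        (0, y.2 - primitive ht.le
          (pointwise (nemytskii _ (continuousOn_sliceDeriv ht hg) z) (S (h, 0))) T) := by
      ext1 <;> simp
    rw [h2, map_add, h1, hΦ2]
    simp
  · have h1 := hid x
    rw [hx] at h1
    rw [hψ, add_comm]
    exact h1

end Problem

end DelayControl

end

/-! ### Normality and conclusion. -/

theorem mainTheorem4 {n m k : ℕ} (P : DelayControl.Problem n m k)
    (ht : P.t₁ < P.t₂) (hτ : 0 < P.τ) (hτ' : P.τ < P.t₂ - P.t₁)
    (hL : ContDiffOn ℝ 1 P.L (Set.Icc P.t₁ P.t₂ ×ˢ Set.univ))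
    (hg : ContDiffOn ℝ 1 P.g (Set.Icc P.t₁ P.t₂ ×ˢ Set.univ))
    (hφ : ContDiffOn ℝ 1 P.φ (Set.Icc P.t₁ P.t₂ ×ˢ Set.univ))
    (q : ℝ → DelayControl.E n) (u : ℝ → DelayControl.E m)
    (hmin : P.IsLocalMinimizer q u) (hnormal : P.IsNormal q u) :
    ∃ (lam : DelayControl.E k) (p : ℝ → DelayControl.E n),
      P.IsPontryaginExtremal q u p lam ∧
      (DelayControl.d₄ P.hamiltonian (DelayControl.delayPt P.τ q u P.t₂) (p P.t₂) lam = 0 →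
        ContDiffOn ℝ 1 p (Set.Icc P.t₁ P.t₂)) := by
  have hadm := hmin.1
  let z := DelayControl.delayPath hτ.le hadm.state_C1.continuousOn hadm.control_C0
  have hz : ∀ t : Set.Icc P.t₁ P.t₂, DelayControl.delayPt P.τ q u t = (↑t, z t) := fun _ => rfl
  obtain ⟨c, mu, hne, hid⟩ :=
    DelayControl.Problem.exists_multipliers ht hτ hL hg hφ hmin z hz
  -- Without a cost multiplier, `mu` is nonzero and gives an extremal of the problem with zero
  -- Lagrangian, which normality excludes.
  by_cases hc : c = 0
  · refine absurd ?_ hnormal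
    have hmu : mu ≠ 0 := hne.resolve_left fun h => h hc
    have hadm₀ : DelayControl.Problem.IsAdmissible { P with L := fun _ => 0 } q u :=
      ⟨hadm.state_C1, hadm.control_C0, hadm.dynamics, hadm.isoperimetric, hadm.initial⟩
    obtain ⟨p, hp, hext, -⟩ := DelayControl.Problem.exists_isPontryaginExtremal
      (P := { P with L := fun _ => 0 }) ht hτ hτ' contDiffOn_const hg hφ hadm₀ z hz mu
      fun x hx => by
        have h1 := hid x hx
        rw [hc, zero_mul, zero_add] at h1
        rw [sub_eq_zero]
        refine Eq.trans ?_ h1.symm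
        have h2 : ∀ ζ, DelayControl.pointwise (DelayControl.nemytskii _
            (DelayControl.continuousOn_sliceDeriv ht (f := fun _ : DelayControl.Pt n m => (0 : ℝ))
              contDiffOn_const) z) ζ = 0 := fun ζ => by
          ext t
          simp [DelayControl.nemytskii, DelayControl.sliceDeriv]
        refine (congrArg (fun w => DelayControl.primitive ht.le w
          ⟨P.t₂, Set.right_mem_Icc.2 ht.le⟩) (h2 _)).trans ?_
        simp
    exact ⟨mu, p, hmu, hp, hext⟩
  -- Dividing the relation by `c` normalizes the cost multiplier to one; the minus sign comes from
  -- `- λ · g` in the Hamiltonian.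
  · obtain ⟨p, -, hext, hC1⟩ := DelayControl.Problem.exists_isPontryaginExtremal
      ht hτ hτ' hL hg hφ hadm z hz (-(c⁻¹ • mu)) fun x hx => by
        have h1 := congrArg (fun r => c⁻¹ * r) (hid x hx)
        simp only [mul_add, mul_zero, inv_mul_cancel_left₀ hc] at h1
        rw [inner_neg_left, real_inner_smul_left, sub_neg_eq_add]
        exact h1
    exact ⟨_, p, hext, hC1⟩
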